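/- Let $p,q\ge 1$, let $t_1,\dots,t_{p+1}\in\mathbb{C}$ be distinct points, no three of them on a straight line, and let $\theta_i$ be a choice of $\arg(t_i-t_{p+1})$ ($1\le i\le p$) and $\theta_{p+1}\in\mathbb{R}$ such that $\theta_1<\theta_2<\dots<\theta_p<\theta_{p+1}<\theta_1+2\pi$. Let $n=\sum_{i=1}^p n_i$ with $n_i=\sum_{k=1}^{r_i}\ell_{i,k}$, and $n=\sum_{k=1}^q m_k$. Let $A\in \mathrm{M}(n;\mathbb{C})$ be partitioned into blocks $A_{ij}$ of size $n_i\times n_j$, such that $$A_{ii}=\mathrm{diag}(\lambda_{i,1}I_{\ell_{i,1}},\dots,\lambda_{i,r_i}I_{\ell_{i,r_i}})\quad(1\le i\le p),$$ and let $P\in\mathrm{GL}(n;\mathbb{C})$ satisfy $P^{-1}AP=\mathrm{diag}(\mu_1I_{m_1},\dots,\mu_qI_{m_q})$. Assume that none of the numbers $$\lambda_{i,k},\quad \lambda_{i,k}-\lambda_{i,h}\ (k\ne h),\quad \mu_k,\quad \mu_k-\mu_h\ (k\neq h),\quad \lambda_{i,k}-\mu_j$$ is an integer. Fix $\eta_0\in\mathbb{C}$,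 put $t'_i=\eta_0+\dfrac1{t_i-t_{p+1}}$ and $\theta'_i=-\theta_i$ for $1\le i\le p$, $\theta'_\infty=-\theta_{p+1}$, $T'=\mathrm{diag}(t'_1I_{n_1},\dots,t'_pI_{n_p})$, and consider, for $\rho\in\mathbb{C}$, the system of rank $n$ $$(\zeta I_n-T')\frac{dw}{d\zeta}=(\rho I_n+A)w \qquad (*)$$ on the cut plane $$\check{\mathcal P}'=\mathbb{C}\setminus\Bigl(\,\bigcup_{i=1}^p\{\eta_0+(t'_i-\eta_0)s\mid 0\le s\le 1\}\cup\{\eta_0+se^{\sqrt{-1}\theta'_\infty}\mid 0\le s<\infty\}\Bigr).$$ Let $\varepsilon_n(j)$ be the $j$-th unit $n$-vector. For $1\le i\le p$, $1\le k\le r_i$, $1\le h\le \ell_{i,k}$, let $w_{t'_i,k,h}(\rho;\zeta)$ be the solution of $(*)$, holomorphic in $\check{\mathcal P}'$, which near $\zeta=t'_i$ has the form $$(\zeta-t'_i)^{\rho+\lambda_{i,k}}\sum_{m=0}^\infty\frac{\Gamma(\rho+\lambda_{i,k}+1)}{\Gamma(\rho+\lambda_{i,k}+1+m)}\,g_{t'_i,k,h}(m)\,(\zeta-t'_i)^m,\qquad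 \arg(\zeta-t'_i)\in(\theta'_i-\pi,\theta'_i+\pi),$$ with $g_{t'_i,k,h}(0)=\varepsilon_n(n_1+\dots+n_{i-1}+\ell_{i,1}+\dots+\ell_{i,k-1}+h)$, the series being convergent for $|\zeta-t'_i|<\min_{j\ne i}|t'_j-t'_i|$. For $1\le k\le q$, $1\le h\le m_k$, let $w_{\infty,k,h}(\rho;\zeta)$ be the solution of $(*)$, holomorphic in $\check{\mathcal P}'$, which for $|\zeta-\eta_0|>\max_j|t'_j-\eta_0|$ is given by the convergent expansion $$\Bigl(\frac1{\zeta-\eta_0}\Bigr)^{-\rho-\mu_k}\sum_{m=0}^\infty\frac{\Gamma(-\rho-\mu_k+m)}{\Gamma(-\rho-\mu_k)}\,g_{\infty,k,h}(m)\Bigl(\frac1{\zeta-\eta_0}\Bigr)^m,\qquad \arg(\zeta-\eta_0)\in(\theta'_\infty,\theta'_\infty+2\pi),$$ with $g_{\infty,k,h}(0)=P\,\varepsilon_n(m_1+\dots+m_{k-1}+h)$. Let the connection coefficients $c_{\infty,\tilde k,\tilde h;t'_i,k,h}(\rho)$ be defined by $$w_{t'_i,k,h}(\rho;\zeta)=\sum_{\tilde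 k=1}^q\sum_{\tilde h=1}^{m_{\tilde k}}c_{\infty,\tilde k,\tilde h;t'_i,k,h}(\rho)\,w_{\infty,\tilde k,\tilde h}(\rho;\zeta)\qquad(\zeta\in\check{\mathcal P}').$$ Then, for every $1\le l\le q$, at $\rho=-\mu_l-1$ such solutions and connection coefficients exist, and $$c_{\infty,l,\tilde h;t'_i,k,h}(-\mu_l-1)=0$$ for all $1\le\tilde h\le m_l$, $1\le i\le p$, $1\le k\le r_i$, $1\le h\le\ell_{i,k}$. -/

import Mathlib

open scoped Matrix Topology

noncomputable section

/-- The complex number `x` is not an integer. -/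
def NotInt (x : ℂ) : Prop := ∀ z : ℤ, x ≠ (z : ℂ)

/-- Row index of a matrix partitioned into `p` blocks, the `i`-th of which is subdivided into
`r i` sub-blocks of sizes `ℓ i 0, ℓ i 1, …`: the triple `⟨i, k, h⟩` is the `h`-th index of the
`k`-th sub-block of the `i`-th block. -/
abbrev RowIndex {p : ℕ} {r : Fin p → ℕ} (ℓ : (i : Fin p) → Fin (r i) → ℕ) : Type :=
  (i : Fin p) × (k : Fin (r i)) × Fin (ℓ i k)

/-- Index of a matrix partitioned into `q` blocks of sizes `m 0, m 1, …`. -/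
abbrev EigIndex {q : ℕ} (m : Fin q → ℕ) : Type := (k : Fin q) × Fin (m k)

/-- The data `T`, `A`, `P`, `t` of the system, with the chosen arguments and with the standing
assumptions. The points are numbered from `0`; the last one, `t (Fin.last p)`, is `t_{p+1}`. -/
structure OkuboData where
  /-- number of distinct eigenvalues of `T` -/
  p : ℕ
  /-- the points `t_1, …, t_{p+1}` -/
  t : Fin (p + 1) → ℂ
  /-- the chosen angles `θ_1, …, θ_{p+1}` -/
  θ : Fin (p + 1) → ℝ
  /-- number of distinct eigenvalues of the diagonal block `A_{ii}` -/
  r : Fin p → ℕ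
  /-- multiplicities of these eigenvalues -/
  ℓ : (i : Fin p) → Fin (r i) → ℕ
  /-- the eigenvalues `λ_{i,k}` of `A_{ii}` -/
  lam : (i : Fin p) → Fin (r i) → ℂ
  /-- number of distinct eigenvalues of `A` -/
  q : ℕ
  /-- multiplicities of these eigenvalues -/
  m : Fin q → ℕ
  /-- the eigenvalues `μ_k` of `A` -/
  mu : Fin q → ℂ
  /-- the coefficient matrix `A` -/
  A : Matrix (RowIndex ℓ) (RowIndex ℓ) ℂ
  /-- the matrix `P` diagonalizing `A` -/
  P : Matrix (RowIndex ℓ) (EigIndex m) ℂ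
  t_injective : Function.Injective t
  not_collinear : ∀ i j k : Fin (p + 1), i ≠ j → j ≠ k → i ≠ k →
    ¬ Collinear ℝ {t i, t j, t k}
  θ_strictMono : StrictMono θ
  θ_lt : θ (Fin.last p) < θ 0 + 2 * Real.pi
  θ_arg : ∀ i : Fin p, t i.castSucc - t (Fin.last p) =
    (‖t i.castSucc - t (Fin.last p)‖ : ℂ) * Complex.exp (θ i.castSucc * Complex.I)
  diag_block : ∀ (i : Fin p) (x y : (k : Fin (r i)) × Fin (ℓ i k)),
    A ⟨i, x⟩ ⟨i, y⟩ = Matrix.diagonal (fun z : (k : Fin (r i)) × Fin (ℓ i k) => lam i z.1) x y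
  P_invertible : ∃ Q : Matrix (EigIndex m) (RowIndex ℓ) ℂ, P * Q = 1 ∧ Q * P = 1
  A_mul_P : A * P = P * Matrix.diagonal (fun b : EigIndex m => mu b.1)
  lam_notInt : ∀ i k, NotInt (lam i k)
  lam_sub_lam : ∀ i k h, k ≠ h → NotInt (lam i k - lam i h)
  mu_notInt : ∀ k, NotInt (mu k)
  mu_sub_mu : ∀ k h, k ≠ h → NotInt (mu k - mu h)
  lam_sub_mu : ∀ i k j, NotInt (lam i k - mu j)

namespace OkuboData

variable (D : OkuboData) (η₀ : ℂ)

/-- Index type of the vectors of rank `n = ∑ ℓ i k`. -/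
abbrev Row : Type := RowIndex D.ℓ

/-- Index type of the eigenvectors of `A`. -/
abbrev Eig : Type := EigIndex D.m

/-- The points `t'_i = η₀ + 1 / (t_i - t_{p+1})`. -/
def t' (i : Fin D.p) : ℂ := η₀ + 1 / (D.t i.castSucc - D.t (Fin.last D.p))

/-- The diagonal matrix `T'`. -/
def T' : Matrix D.Row D.Row ℂ := Matrix.diagonal fun a => D.t' η₀ a.1

/-- The chosen argument `θ'_i = -θ_i` of `t'_i - η₀`. -/
def θ' (i : Fin D.p) : ℝ := -D.θ i.castSucc

/-- The direction `θ'_∞ = -θ_{p+1}`. -/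
def θ'inf : ℝ := -D.θ (Fin.last D.p)

/-- The plane cut along the segments from `η₀` to the `t'_i` and along the ray from `η₀` in the
direction `θ'_∞`. -/
def cutPlane : Set ℂ :=
  {ζ | (∀ i : Fin D.p, ∀ s : ℝ, 0 ≤ s → s ≤ 1 → ζ ≠ η₀ + (D.t' η₀ i - η₀) * s) ∧
    ∀ s : ℝ, 0 ≤ s → ζ ≠ η₀ + s * Complex.exp (D.θ'inf * Complex.I)}

/-- `w` is a holomorphic solution on `S` of the underlying system
`(ζ I - T') dw/dζ = (ρ I + A) w`. -/
def IsSolutionOn (ρ : ℂ) (S : Set ℂ) (w : ℂ → D.Row → ℂ) : Prop :=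
  ∀ ζ ∈ S, DifferentiableAt ℂ w ζ ∧
    (ζ • (1 : Matrix D.Row D.Row ℂ) - D.T' η₀) *ᵥ deriv w ζ =
      (ρ • (1 : Matrix D.Row D.Row ℂ) + D.A) *ᵥ w ζ

/-- The logarithm of `z ≠ 0` whose imaginary part lies in `(φ - π, φ + π]`. -/
def logBranch (φ : ℝ) (z : ℂ) : ℂ :=
  Complex.log (z * Complex.exp (-(φ * Complex.I))) + φ * Complex.I

/-- `w` is (the continuation to the cut plane of) the solution `w_{t'_i,k,h}(ρ; ·)`, where
`a = ⟨i, k, h⟩`: the solution which near `t'_i` is given by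
`(ζ - t'_i)^(ρ + λ) ∑ Γ(ρ + λ + 1) / Γ(ρ + λ + 1 + m) g(m) (ζ - t'_i)^m`, `λ = λ_{i,k}`, with
`g(0)` the unit vector of index `a` and `arg (ζ - t'_i) ∈ (θ'_i - π, θ'_i + π)`,
the series being convergent for `|ζ - t'_i| < min_{j ≠ i} |t'_j - t'_i|`. -/
def IsFiniteSolution (ρ : ℂ) (a : D.Row) (w : ℂ → D.Row → ℂ) : Prop :=
  D.IsSolutionOn η₀ ρ (D.cutPlane η₀) w ∧
  ∃ g : ℕ → D.Row → ℂ, g 0 = Pi.single a 1 ∧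
    (∀ ζ : ℂ, (∀ j, j ≠ a.1 → ‖ζ - D.t' η₀ a.1‖ < ‖D.t' η₀ j - D.t' η₀ a.1‖) →
      Summable fun m : ℕ =>
        (Complex.Gamma (ρ + D.lam a.1 a.2.1 + 1) / Complex.Gamma (ρ + D.lam a.1 a.2.1 + 1 + m) *
          (ζ - D.t' η₀ a.1) ^ m) • g m) ∧
    ∀ᶠ ζ in 𝓝[D.cutPlane η₀] (D.t' η₀ a.1),
      w ζ = Complex.exp ((ρ + D.lam a.1 a.2.1) * logBranch (D.θ' a.1) (ζ - D.t' η₀ a.1)) •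
        ∑' m : ℕ,
          (Complex.Gamma (ρ + D.lam a.1 a.2.1 + 1) / Complex.Gamma (ρ + D.lam a.1 a.2.1 + 1 + m) *
            (ζ - D.t' η₀ a.1) ^ m) • g m

/-- `w` is (the continuation to the cut plane of) the solution `w_{∞,k,h}(ρ; ·)`, where
`b = ⟨k, h⟩`: the solution which for `|ζ - η₀| > max_j |t'_j - η₀|` is given by the
convergent expansion
`(1 / (ζ - η₀))^(-ρ - μ) ∑ Γ(-ρ - μ + m) / Γ(-ρ - μ) g(m) (1 / (ζ - η₀))^m`, `μ = μ_k`, with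
`g(0)` the `b`-th column of `P` and `arg (ζ - η₀) ∈ (θ'_∞, θ'_∞ + 2π)`. -/
def IsInfinitySolution (ρ : ℂ) (b : D.Eig) (w : ℂ → D.Row → ℂ) : Prop :=
  D.IsSolutionOn η₀ ρ (D.cutPlane η₀) w ∧
  ∃ g : ℕ → D.Row → ℂ, g 0 = D.P *ᵥ Pi.single b 1 ∧
    ∀ ζ ∈ D.cutPlane η₀, (∀ j, ‖D.t' η₀ j - η₀‖ < ‖ζ - η₀‖) →
      HasSum (fun m : ℕ =>
        (Complex.exp ((ρ + D.mu b.1) * logBranch (D.θ'inf + Real.pi) (ζ - η₀)) *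
          (Complex.Gamma (-ρ - D.mu b.1 + m) / Complex.Gamma (-ρ - D.mu b.1) *
            (1 / (ζ - η₀)) ^ m)) • g m) (w ζ)

/-- `c b a` (`a = ⟨i, k, h⟩`, `b = ⟨k̃, h̃⟩`) are the connection coefficients
`c_{∞,k̃,h̃;t'_i,k,h}(ρ)`: in the cut plane each `w_{t'_i,k,h}(ρ; ·)` is the linear combination
of the `w_{∞,k̃,h̃}(ρ; ·)` with these coefficients. -/
def IsConnectionCoeff (ρ : ℂ) (c : D.Eig → D.Row → ℂ) : Prop :=
  ∃ (wfin : D.Row → ℂ → D.Row → ℂ) (winf : D.Eig → ℂ → D.Row → ℂ),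
    (∀ a, D.IsFiniteSolution η₀ ρ a (wfin a)) ∧
    (∀ b, D.IsInfinitySolution η₀ ρ b (winf b)) ∧
    ∀ a, ∀ ζ ∈ D.cutPlane η₀, wfin a ζ = ∑ b, c b a • winf b ζ

end OkuboData

end

open scoped Matrix Topology

noncomputable section

/-! ### Power series with coefficients in a Banach space -/

/-! The vanishing comes from a first integral. At ρ = -μ_l - 1 a row eigenvector v of A for μ_l
satisfies d/dζ [v(ζ - T')w] = v(1 + ρ + A)w = 0, so F(w) = v(ζ - T')w is constant on the cut plane
for every solution w (`hasDerivAt_firstIntegral`). Near t'_i a finite solution makes F a power with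
nonintegral exponent times a function holomorphic across the slit; such a product is constant only
if it is 0 (`eq_zero_of_nonintegral_power`). The same argument at infinity gives F = 0 for solutions
with exponent μ_k, k ≠ l. For k = l the exponent -1 cancels the growth of ζ - T', and F is the value
v · g(0) at infinity. With v a row of P⁻¹, F is therefore dual to the solutions w_{∞,l,·}; applied
to the connection relation it returns the coefficient, which must be 0
(`IsConnectionCoeff.eq_zero`).

The longer task is existence. In the coordinate s = log(ζ - η₀) the cuts become the edges of a
horizontal strip and half-lines going left. Moving right therefore never meets a cut, and local
solutions can be glued without a monodromy argument (`IsRightwardDomain`). The series at infinity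
converges outside a circle and extends to the cut plane; leading terms given by the columns of P
make these solutions a basis. The Frobenius series at t'_i is matched at one point by a combination
of this basis, and uniqueness yields both its continuation and the connection coefficients
(`exists_isFiniteSolution`). -/

theorem summable_and_hasDerivAt_tsum_pow_smul {V : Type*} [NormedAddCommGroup V] [NormedSpace ℂ V]
    [CompleteSpace V] {b : ℕ → V} {x y : ℂ} (hs : Summable fun m => y ^ m • b m)
    (hx : ‖x‖ < ‖y‖) :
    (Summable fun m => x ^ m • b m) ∧ (Summable fun m : ℕ => ((m : ℂ) * x ^ m) • b m) ∧
      HasDerivAt (fun z => ∑' m, z ^ m • b m) (∑' m : ℕ, ((m : ℂ) * x ^ (m - 1)) • b m) x := by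
  obtain ⟨C, hC⟩ := hs.tendsto_atTop_zero.norm.bddAbove_range
  have hC' : ∀ m, ‖y‖ ^ m * ‖b m‖ ≤ C := fun m => by
    have := hC (Set.mem_range_self m)
    simpa [norm_smul] using this
  have hC0 : 0 ≤ C := le_trans (by positivity) (hC' 0)
  -- On the disc of radius r the terms are dominated by a geometric series of ratio r/‖y‖ < 1, which
  -- leaves room for the factor m produced by differentiation.
  obtain ⟨r, hxr, hry⟩ := exists_between hx
  have hr : 0 < r := (norm_nonneg x).trans_lt hxr
  have hy : 0 < ‖y‖ := hr.trans hry
  have hq : ‖r / ‖y‖‖ < 1 := by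
    rw [Real.norm_of_nonneg (by positivity)]; exact (div_lt_one hy).2 hry
  have key : ∀ m, r ^ m * ‖b m‖ ≤ C * (r / ‖y‖) ^ m := fun m => by
    have h1 : r ^ m * ‖b m‖ = (‖y‖ ^ m * ‖b m‖) * (r / ‖y‖) ^ m := by
      rw [div_pow]
      field_simp
    rw [h1]
    exact mul_le_mul_of_nonneg_right (hC' m) (by positivity)
  have hgeo : Summable fun m : ℕ => C * (r / ‖y‖) ^ m :=
    (summable_geometric_of_norm_lt_one hq).mul_left C
  have hgeo1 : Summable fun m : ℕ => (m : ℝ) * (C * (r / ‖y‖) ^ m) := by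
    have := (summable_pow_mul_geometric_of_norm_lt_one 1 hq).mul_left C
    refine this.congr fun m => ?_
    simp; ring
  have s0 : Summable fun m => x ^ m • b m := by
    refine Summable.of_norm_bounded hgeo fun m => le_trans ?_ (key m)
    rw [norm_smul, norm_pow]; gcongr
  refine ⟨s0, ?_, ?_⟩
  · refine Summable.of_norm_bounded hgeo1 fun m => ?_
    rw [norm_smul, norm_mul, norm_pow, Complex.norm_natCast, mul_assoc]
    exact mul_le_mul_of_nonneg_left ((mul_le_mul_of_nonneg_right
      (pow_le_pow_left₀ (norm_nonneg _) hxr.le m) (norm_nonneg _)).trans (key m))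
      (Nat.cast_nonneg _)
  · refine hasDerivAt_tsum_of_isPreconnected (t := Metric.ball 0 r) (y₀ := x)
      (g := fun (m : ℕ) (z : ℂ) => z ^ m • b m)
      (g' := fun (m : ℕ) (z : ℂ) => ((m : ℂ) * z ^ (m - 1)) • b m)
      (u := fun m : ℕ => r⁻¹ * ((m : ℝ) * (C * (r / ‖y‖) ^ m)))
      (hgeo1.mul_left _) Metric.isOpen_ball
      (convex_ball (0 : ℂ) r).isPreconnected ?_ ?_ (by simpa using hxr) s0 (by simpa using hxr)
    · intro m z _
      exact (hasDerivAt_pow m z).smul_const (b m)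
    · intro m z hz
      have hz' : ‖z‖ < r := by simpa using hz
      rcases m with _ | m
      · simp
      · rw [norm_smul, norm_mul, norm_pow, Complex.norm_natCast, Nat.add_sub_cancel]
        have h2 := key (m + 1)
        calc ((m + 1 : ℕ) : ℝ) * ‖z‖ ^ m * ‖b (m + 1)‖
            ≤ ((m + 1 : ℕ) : ℝ) * r ^ m * ‖b (m + 1)‖ :=
              mul_le_mul_of_nonneg_right (mul_le_mul_of_nonneg_left
                (pow_le_pow_left₀ (norm_nonneg _) hz'.le m) (Nat.cast_nonneg _)) (norm_nonneg _)
          _ = r⁻¹ * (((m + 1 : ℕ) : ℝ) * (r ^ (m + 1) * ‖b (m + 1)‖)) := by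
            field_simp
            ring
          _ ≤ _ := mul_le_mul_of_nonneg_left
              (mul_le_mul_of_nonneg_left h2 (Nat.cast_nonneg _)) (inv_nonneg.2 hr.le)

/-- The Euler operator acts on a power series by multiplying the `m`-th coefficient by `m`. -/
theorem hasSum_euler {V : Type*} [NormedAddCommGroup V] [NormedSpace ℂ V]
    [CompleteSpace V] {b : ℕ → V} {x y : ℂ} (hs : Summable fun m => y ^ m • b m)
    (hx : ‖x‖ < ‖y‖) :
    ∃ h' : V, HasDerivAt (fun z => ∑' m, z ^ m • b m) h' x ∧
      HasSum (fun m : ℕ => ((m : ℂ) * x ^ m) • b m) (x • h') := by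
  obtain ⟨-, s1, hd⟩ := summable_and_hasDerivAt_tsum_pow_smul hs hx
  refine ⟨_, hd, ?_⟩
  rcases eq_or_ne x 0 with rfl | hx0
  · rw [zero_smul]
    convert hasSum_zero with m
    rcases m with _ | m <;> simp
  · convert s1.hasSum using 1
    rw [← tsum_const_smul'' x]
    congr 1
    ext1 m
    rw [smul_smul]
    rcases m with _ | m
    · simp
    · congr 1
      rw [Nat.add_sub_cancel, pow_succ]; ring

/-- The ratio bound R(m + C)/(m - C) tends to R; the shift C absorbs the norms of the exponent and
of the coefficient matrix. Cleared of denominators, the hypothesis is harmless for m ≤ C. -/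
theorem summable_pow_smul_of_ratio_le {V : Type*} [NormedAddCommGroup V] [NormedSpace ℂ V]
    [CompleteSpace V] {b : ℕ → V} {x : ℂ} {R C : ℝ} (hR : 0 ≤ R) (hC : 0 ≤ C)
    (hx : R * ‖x‖ < 1)
    (hb : ∀ m : ℕ, (m - C) * ‖b (m + 1)‖ ≤ (m + C) * R * ‖b m‖) :
    Summable fun m => x ^ m • b m := by
  obtain ⟨κ, h1, h2⟩ := exists_between hx
  have hκ : 0 < κ := lt_of_le_of_lt (by positivity) h1
  refine summable_of_ratio_norm_eventually_le h2 ?_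
  have hd : 0 < κ - R * ‖x‖ := by linarith
  -- The quotient is the threshold beyond which (m + C) R‖x‖ ≤ (m - C) κ; the extra C makes m - C
  -- positive.
  filter_upwards [(tendsto_natCast_atTop_atTop (R := ℝ)).eventually_gt_atTop
    (C + (C * (κ + R * ‖x‖)) / (κ - R * ‖x‖))] with m hm
  have hq : 0 ≤ (C * (κ + R * ‖x‖)) / (κ - R * ‖x‖) := by positivity
  have hmC : 0 < (m : ℝ) - C := by linarith
  have h3 : (C * (κ + R * ‖x‖)) / (κ - R * ‖x‖) < m := by linarith
  rw [div_lt_iff₀ hd] at h3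
  rw [norm_smul, norm_smul, norm_pow, norm_pow, pow_succ]
  refine le_of_mul_le_mul_left ?_ hmC
  calc ((m : ℝ) - C) * (‖x‖ ^ m * ‖x‖ * ‖b (m + 1)‖)
      = ‖x‖ ^ m * ‖x‖ * (((m : ℝ) - C) * ‖b (m + 1)‖) := by ring
    _ ≤ ‖x‖ ^ m * ‖x‖ * ((m + C) * R * ‖b m‖) :=
        mul_le_mul_of_nonneg_left (hb m) (by positivity)
    _ = ((m + C) * (R * ‖x‖)) * (‖x‖ ^ m * ‖b m‖) := by ring
    _ ≤ ((m - C) * κ) * (‖x‖ ^ m * ‖b m‖) := by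
        refine mul_le_mul_of_nonneg_right ?_ (by positivity)
        linarith
    _ = _ := by ring

/-! ### Linear differential equations in the complex domain -/

/-- Grönwall's inequality on the segment from z₀ to z, where ‖B‖ is bounded by compactness. -/
theorem eq_zero_of_starConvex {V : Type*} [NormedAddCommGroup V] [NormedSpace ℂ V]
    {S : Set ℂ} {z₀ : ℂ} {B : ℂ → V →L[ℂ] V} {w : ℂ → V} (hS : StarConvex ℝ z₀ S)
    (hB : ContinuousOn B S) (hw : ∀ z ∈ S, HasDerivAt w (B z (w z)) z) (h0 : w z₀ = 0) :
    ∀ z ∈ S, w z = 0 := by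
  intro z hz
  set γ : ℝ → ℂ := fun s => z₀ + s • (z - z₀) with hγ
  have hγS : ∀ s ∈ Set.Icc (0 : ℝ) 1, γ s ∈ S := fun s hs =>
    hS.add_smul_sub_mem hz hs.1 hs.2
  have hγc : Continuous γ := by fun_prop
  have hBc : ContinuousOn (fun s => ‖B (γ s)‖) (Set.Icc (0 : ℝ) 1) :=
    (hB.comp hγc.continuousOn hγS).norm
  obtain ⟨M, hM⟩ := isCompact_Icc.bddAbove_image hBc
  have hγd : ∀ s, HasDerivAt γ (z - z₀) s := fun s => by
    simpa [hγ] using ((hasDerivAt_id s).smul_const (z - z₀)).const_add z₀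
  have hd : ∀ s ∈ Set.Icc (0 : ℝ) 1,
      HasDerivAt (fun s => w (γ s)) ((z - z₀) • B (γ s) (w (γ s))) s := fun s hs =>
    (hw _ (hγS s hs)).scomp s (hγd s)
  have := eq_zero_of_abs_deriv_le_mul_abs_self_of_eq_zero_right (f := fun s => w (γ s))
    (K := ‖z - z₀‖ * M) (a := 0) (b := 1)
    (fun s hs => (hd s hs).continuousAt.continuousWithinAt)
    (fun s hs => (hd s (Set.Ico_subset_Icc_self hs)).hasDerivWithinAt) (by simp [hγ, h0])
    (fun s hs => by
      rw [norm_smul, mul_assoc]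
      gcongr
      refine (ContinuousLinearMap.le_opNorm _ _).trans ?_
      gcongr
      exact hM (Set.mem_image_of_mem _ (Set.Ico_subset_Icc_self hs)))
    1 (by simp)
  simpa [hγ] using this

theorem exists_primitive_of_convex {V : Type*} [NormedAddCommGroup V] [NormedSpace ℂ V]
    [CompleteSpace V] {U : Set ℂ} (hU : IsOpen U) (hc : Convex ℝ U) {f : ℂ → V}
    (hf : DifferentiableOn ℂ f U) (z₀ : ℂ) :
    ∃ F : ℂ → V, F z₀ = 0 ∧ ∀ z ∈ U, HasDerivAt F (f z) z := by
  obtain ⟨F, hF⟩ := hc.exists_forall_hasDerivWithinAt hf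
  exact ⟨fun z => F z - F z₀, sub_self _, fun z hz =>
    ((hF z hz).hasDerivAt (hU.mem_nhds hz)).sub_const _⟩

/-- Estimate of the Picard iterates on a star-shaped set. -/
theorem norm_iterate_le_of_starConvex {V : Type*} [NormedAddCommGroup V] [NormedSpace ℂ V]
    {K : Set ℂ} {z₀ : ℂ} {B : ℂ → V →L[ℂ] V} {W : ℕ → ℂ → V} {M C : ℝ} (hK : StarConvex ℝ z₀ K)
    (hM : ∀ z ∈ K, ‖B z‖ ≤ M) (h0 : ∀ z ∈ K, ‖W 0 z‖ ≤ C) (hW0 : ∀ n, W (n + 1) z₀ = 0)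
    (hW : ∀ n, ∀ z ∈ K, HasDerivAt (W (n + 1)) (B z (W n z)) z) (n : ℕ) :
    ∀ z ∈ K, ‖W n z‖ ≤ C * ((M * ‖z - z₀‖) ^ n / n.factorial) := by
  induction n with
  | zero => simpa using h0
  | succ n ih =>
    intro z hz
    have hM0 : 0 ≤ M := (norm_nonneg _).trans (hM z hz)
    set γ : ℝ → ℂ := fun s => z₀ + s • (z - z₀) with hγ
    have hγS : ∀ s ∈ Set.Icc (0 : ℝ) 1, γ s ∈ K := fun s hs =>
      hK.add_smul_sub_mem hz hs.1 hs.2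
    have hγd : ∀ s, HasDerivAt γ (z - z₀) s := fun s => by
      simpa [hγ] using ((hasDerivAt_id s).smul_const (z - z₀)).const_add z₀
    have hd : ∀ s ∈ Set.Icc (0 : ℝ) 1,
        HasDerivAt (fun s => W (n + 1) (γ s)) ((z - z₀) • B (γ s) (W n (γ s))) s := fun s hs =>
      (hW n _ (hγS s hs)).scomp s (hγd s)
    have key := image_norm_le_of_norm_deriv_right_le_deriv_boundary
      (f := fun s => W (n + 1) (γ s)) (a := 0) (b := 1)
      (f' := fun s => (z - z₀) • B (γ s) (W n (γ s)))
      (B := fun s => C * ((M * ‖z - z₀‖) ^ (n + 1) / (n + 1).factorial) * s ^ (n + 1))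
      (B' := fun s => C * ((M * ‖z - z₀‖) ^ (n + 1) / (n + 1).factorial) * ((n + 1 : ℕ) * s ^ n))
      (fun s hs => (hd s hs).continuousAt.continuousWithinAt)
      (fun s hs => (hd s (Set.Ico_subset_Icc_self hs)).hasDerivWithinAt)
      (by simp [hγ, hW0])
      (fun s => by
        have := (hasDerivAt_pow (n + 1) s).const_mul
          (C * ((M * ‖z - z₀‖) ^ (n + 1) / (n + 1).factorial))
        simpa using this)
      (fun s hs => by
        have hs' := Set.Ico_subset_Icc_self hs
        have hn : ‖γ s - z₀‖ = s * ‖z - z₀‖ := by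
          simp [hγ, abs_of_nonneg hs.1]
        have h1 : ‖B (γ s) (W n (γ s))‖ ≤
            M * (C * ((M * (s * ‖z - z₀‖)) ^ n / n.factorial)) := by
          refine (ContinuousLinearMap.le_opNorm _ _).trans ?_
          have h2 := ih _ (hγS s hs')
          rw [hn] at h2
          gcongr
          exact hM _ (hγS s hs')
        rw [norm_smul]
        calc ‖z - z₀‖ * ‖B (γ s) (W n (γ s))‖
            ≤ ‖z - z₀‖ * (M * (C * ((M * (s * ‖z - z₀‖)) ^ n / n.factorial))) := by gcongr
          _ = _ := by
            rw [Nat.factorial_succ]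
            push_cast
            field_simp
            ring)
      (x := 1) (by simp)
    simpa [hγ] using key

/-- A holomorphic linear differential equation on an open convex set has a solution with any
prescribed initial value. -/
theorem exists_solution_of_convex {V : Type*} [NormedAddCommGroup V] [NormedSpace ℂ V]
    [CompleteSpace V] {U : Set ℂ} (hU : IsOpen U) (hc : Convex ℝ U) {B : ℂ → V →L[ℂ] V}
    (hB : DifferentiableOn ℂ B U) {z₀ : ℂ} (hz₀ : z₀ ∈ U) (v : V) :
    ∃ w : ℂ → V, w z₀ = v ∧ ∀ z ∈ U, HasDerivAt w (B z (w z)) z := by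
  have hstep : ∀ f : {f : ℂ → V // DifferentiableOn ℂ f U},
      ∃ F : {f : ℂ → V // DifferentiableOn ℂ f U},
        F.1 z₀ = 0 ∧ ∀ z ∈ U, HasDerivAt F.1 (B z (f.1 z)) z := fun f => by
    obtain ⟨F, hF0, hF⟩ := exists_primitive_of_convex hU hc (hB.clm_apply f.2) z₀
    exact ⟨⟨F, fun z hz => (hF z hz).differentiableAt.differentiableWithinAt⟩, hF0, hF⟩
  choose Φ hΦ0 hΦ using hstep
  -- Increments of the Picard iteration: each is the primitive, vanishing at z₀, of B applied to its
  -- predecessor. The solution is their sum.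
  let W : ℕ → {f : ℂ → V // DifferentiableOn ℂ f U} := fun n =>
    Nat.rec ⟨fun _ => v, differentiableOn_const v⟩ (fun _ f => Φ f) n
  have hW0 : ∀ n, (W (n + 1)).1 z₀ = 0 := fun n => hΦ0 _
  have hW : ∀ n, ∀ z ∈ U, HasDerivAt (W (n + 1)).1 (B z ((W n).1 z)) z := fun n => hΦ _
  refine ⟨fun z => ∑' n, (W n).1 z, ?_, fun z hz => ?_⟩
  · refine tsum_eq_single 0 fun n hn => ?_
    obtain ⟨n, rfl⟩ := Nat.exists_eq_succ_of_ne_zero hn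
    exact hW0 n
  · obtain ⟨r, hr, hrU⟩ := Metric.nhds_basis_closedBall.mem_iff.1 (hU.mem_nhds hz)
    -- The union of all segments from z₀ to a closed ball about z. It is compact, so B is bounded on
    -- it, and star-shaped about z₀, as the iterate estimate requires.
    set K := (fun p : ℝ × ℂ => z₀ + p.1 • (p.2 - z₀)) ''
      (Set.Icc (0 : ℝ) 1 ×ˢ Metric.closedBall z r) with hKdef
    have hKU : K ⊆ U := by
      rintro _ ⟨⟨s, y⟩, ⟨hs, hy⟩, rfl⟩
      exact hc.add_smul_sub_mem hz₀ (hrU hy) hs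
    have hKc : IsCompact K :=
      (isCompact_Icc.prod (isCompact_closedBall z r)).image (by fun_prop)
    have hK0 : z₀ ∈ K := ⟨(0, z), ⟨by simp, Metric.mem_closedBall_self hr.le⟩, by simp⟩
    have hKs : StarConvex ℝ z₀ K := by
      refine starConvex_iff_forall_pos hK0 |>.2 ?_
      rintro _ ⟨⟨s, y⟩, ⟨hs, hy⟩, rfl⟩ a c ha hc hac
      refine ⟨(c * s, y), ⟨⟨mul_nonneg hc.le hs.1, by nlinarith [hs.1, hs.2]⟩, hy⟩, ?_⟩
      obtain rfl : a = 1 - c := by linarith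
      simp only [Complex.real_smul]
      push_cast
      ring
    have hbK : Metric.ball z r ⊆ K := fun y hy =>
      ⟨(1, y), ⟨by simp, Metric.ball_subset_closedBall hy⟩, by simp⟩
    obtain ⟨M, hM⟩ := hKc.bddAbove_image (f := fun z => ‖B z‖)
      ((hB.continuousOn.mono hKU).norm)
    have hM' : ∀ y ∈ K, ‖B y‖ ≤ M := fun y hy => hM (Set.mem_image_of_mem _ hy)
    obtain ⟨L, hL⟩ := hKc.bddAbove_image (f := fun y => ‖y - z₀‖) (by fun_prop)
    have hL' : ∀ y ∈ K, ‖y - z₀‖ ≤ L := fun y hy => hL (Set.mem_image_of_mem _ hy)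
    have hM0 : 0 ≤ M := (norm_nonneg _).trans (hM' z₀ hK0)
    have hbound : ∀ n, ∀ y ∈ K, ‖(W n).1 y‖ ≤ ‖v‖ * ((M * L) ^ n / n.factorial) := by
      intro n y hy
      refine (norm_iterate_le_of_starConvex (W := fun n => (W n).1) hKs hM'
        (fun _ _ => le_refl ‖v‖) hW0
        (fun n y hy => hW n y (hKU hy)) n y hy).trans ?_
      gcongr
      exact hL' y hy
    have hsum : Summable fun n : ℕ => ‖v‖ * ((M * L) ^ n / n.factorial) :=
      (Real.summable_pow_div_factorial _).mul_left _
    have hzb : z ∈ Metric.ball z r := Metric.mem_ball_self hr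
    have hs : ∀ y ∈ K, Summable fun n => (W n).1 y := fun y hy =>
      Summable.of_norm_bounded hsum fun n => hbound n y hy
    have h1 := hasDerivAt_tsum_of_isPreconnected (𝕜 := ℂ) (t := Metric.ball z r)
      (g := fun n y => (W (n + 1)).1 y) (g' := fun n y => B y ((W n).1 y))
      (hsum.mul_left M) Metric.isOpen_ball (convex_ball z r).isPreconnected
      (fun n y hy => hW n y (hKU (hbK hy)))
      (fun n y hy => ((B y).le_opNorm _).trans (by
        gcongr
        · exact hM' y (hbK hy)
        · exact hbound n y (hbK hy))) hzb ((summable_nat_add_iff 1).2 (hs z (hbK hzb))) hzb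
    rw [(B z).map_tsum (hs z (hbK hzb))]
    refine (h1.const_add v).congr_of_eventuallyEq ?_
    filter_upwards [Metric.isOpen_ball.mem_nhds hzb] with y hy
    exact (hs y (hbK hy)).tsum_eq_zero_add

/-! ### Continuation of solutions along half-strips -/

/-- The open half-strip to the right of `s`. -/
def halfStrip (s : ℂ) (ε : ℝ) : Set ℂ := {z | s.re - ε < z.re ∧ |z.im - s.im| < ε}

theorem isOpen_halfStrip (s : ℂ) (ε : ℝ) : IsOpen (halfStrip s ε) :=
  (isOpen_lt continuous_const Complex.continuous_re).inter
    (isOpen_lt (Complex.continuous_im.sub continuous_const).abs continuous_const)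

theorem convex_halfStrip (s : ℂ) (ε : ℝ) : Convex ℝ (halfStrip s ε) := by
  intro x hx y hy a b ha hb hab
  simp only [halfStrip, Set.mem_ofPred_eq, abs_lt] at hx hy ⊢
  obtain ⟨h1, h2, h3⟩ := hx
  obtain ⟨k1, k2, k3⟩ := hy
  obtain rfl : b = 1 - a := by linarith
  simp only [Complex.add_re, Complex.real_smul, Complex.mul_re, Complex.ofReal_re,
    Complex.ofReal_im, Complex.add_im, Complex.mul_im]
  rcases eq_or_lt_of_le ha with rfl | ha'
  · refine ⟨?_, ?_, ?_⟩ <;> linarith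
  · refine ⟨?_, ?_, ?_⟩ <;> nlinarith

theorem self_mem_halfStrip (s : ℂ) {ε : ℝ} (hε : 0 < ε) : s ∈ halfStrip s ε := by
  simp [halfStrip, hε]

theorem add_mem_halfStrip {s z : ℂ} {ε : ℝ} (hz : z ∈ halfStrip s ε) {x : ℝ} (hx : 0 ≤ x) :
    z + x ∈ halfStrip s ε := by
  obtain ⟨h1, h2⟩ := hz
  refine ⟨?_, by simpa using h2⟩
  simp only [Complex.add_re, Complex.ofReal_re]
  linarith

/-- An open set `Ω` of the plane which contains with each point an open half-strip to its right,
each such half-strip finally entering the convex open set `E ⊆ Ω`. -/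
structure IsRightwardDomain (Ω E : Set ℂ) : Prop where
  isOpen_core : IsOpen E
  convex_core : Convex ℝ E
  core_subset : E ⊆ Ω
  exists_halfStrip : ∀ s ∈ Ω, ∃ ε > 0, halfStrip s ε ⊆ Ω
  exists_add_mem_core : ∀ s ∈ Ω, ∃ x : ℝ, 0 ≤ x ∧ s + x ∈ E

namespace IsRightwardDomain

variable {Ω E : Set ℂ}

/-- The zero travels right along a half-strip into the core, spreads over the convex core, and
returns to any other point along its own half-strip. -/
theorem eq_zero {V : Type*} [NormedAddCommGroup V] [NormedSpace ℂ V]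
    (h : IsRightwardDomain Ω E) {B : ℂ → V →L[ℂ] V} (hB : ContinuousOn B Ω) {w : ℂ → V}
    (hw : ∀ z ∈ Ω, HasDerivAt w (B z (w z)) z) {z₀ : ℂ} (hz₀ : z₀ ∈ Ω) (h0 : w z₀ = 0) :
    ∀ z ∈ Ω, w z = 0 := by
  have strip : ∀ s ∈ Ω, ∀ ε > 0, halfStrip s ε ⊆ Ω → ∀ y ∈ halfStrip s ε, w y = 0 →
      ∀ z ∈ halfStrip s ε, w z = 0 := fun s _ ε _ hsub y hy h0 =>
    eq_zero_of_starConvex ((convex_halfStrip s ε).starConvex hy) (hB.mono hsub)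
      (fun z hz => hw z (hsub hz)) h0
  have core : ∀ z ∈ E, w z = 0 := by
    obtain ⟨ε, hε, hsub⟩ := h.exists_halfStrip z₀ hz₀
    obtain ⟨x, hx, hxE⟩ := h.exists_add_mem_core z₀ hz₀
    exact eq_zero_of_starConvex (h.convex_core.starConvex hxE) (hB.mono h.core_subset)
      (fun z hz => hw z (h.core_subset hz))
      (strip z₀ hz₀ ε hε hsub z₀ (self_mem_halfStrip _ hε) h0 _
        (add_mem_halfStrip (self_mem_halfStrip _ hε) hx))
  intro z hz
  obtain ⟨ε, hε, hsub⟩ := h.exists_halfStrip z hz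
  obtain ⟨x, hx, hxE⟩ := h.exists_add_mem_core z hz
  exact strip z hz ε hε hsub _ (add_mem_halfStrip (self_mem_halfStrip _ hε) hx) (core _ hxE) z
    (self_mem_halfStrip _ hε)

/-- Solve on each half-strip with initial value read from w at a core point. If z lies in the strip
of s, the strips of z and s have a convex intersection which reaches the core to the right of z, so
the two solutions agree there. Hence the value at z of its own solution defines a function that
locally is a single solution. -/
theorem exists_extension {V : Type*} [NormedAddCommGroup V] [NormedSpace ℂ V] [CompleteSpace V]
    (h : IsRightwardDomain Ω E) {B : ℂ → V →L[ℂ] V} (hB : DifferentiableOn ℂ B Ω) {w : ℂ → V}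
    (hw : ∀ z ∈ E, HasDerivAt w (B z (w z)) z) :
    ∃ W : ℂ → V, (∀ z ∈ Ω, HasDerivAt W (B z (W z)) z) ∧ ∀ z ∈ E, W z = w z := by
  have hloc : ∀ s : Ω, ∃ ε > 0, halfStrip (s : ℂ) ε ⊆ Ω ∧ ∃ f : ℂ → V,
      (∀ z ∈ halfStrip (s : ℂ) ε, HasDerivAt f (B z (f z)) z) ∧
      ∀ z ∈ halfStrip (s : ℂ) ε ∩ E, f z = w z := by
    rintro ⟨s, hs⟩
    obtain ⟨ε, hε, hsub⟩ := h.exists_halfStrip s hs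
    obtain ⟨x, hx, hxE⟩ := h.exists_add_mem_core s hs
    have hxN := add_mem_halfStrip (self_mem_halfStrip s hε) hx
    obtain ⟨f, hf0, hf⟩ := exists_solution_of_convex (isOpen_halfStrip s ε)
      (convex_halfStrip s ε) (hB.mono hsub) hxN (w (s + x))
    refine ⟨ε, hε, hsub, f, hf, fun z hz => ?_⟩
    refine sub_eq_zero.1 (eq_zero_of_starConvex (w := fun z => f z - w z)
      (((convex_halfStrip s ε).inter h.convex_core).starConvex ⟨hxN, hxE⟩)
      (hB.continuousOn.mono (Set.inter_subset_left.trans hsub)) (fun y hy => ?_)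
      (by simp [hf0]) z hz)
    rw [map_sub]
    exact (hf y hy.1).sub (hw y hy.2)
  choose ε hε hsub f hf hfw using hloc
  classical
  have hW : ∀ s : Ω, ∀ z (hz : z ∈ Ω), z ∈ halfStrip (s : ℂ) (ε s) → f ⟨z, hz⟩ z = f s z := by
    intro s z hz hzs
    obtain ⟨x, hx, hxE⟩ := h.exists_add_mem_core z hz
    have hz' := self_mem_halfStrip z (hε ⟨z, hz⟩)
    have h1 := add_mem_halfStrip hzs hx
    have h2 := add_mem_halfStrip hz' hx
    refine sub_eq_zero.1 (eq_zero_of_starConvex (w := fun y => f ⟨z, hz⟩ y - f s y) (B := B)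
      (((convex_halfStrip z (ε ⟨z, hz⟩)).inter (convex_halfStrip s (ε s))).starConvex ⟨h2, h1⟩)
      (hB.continuousOn.mono (Set.inter_subset_right.trans (hsub s))) (fun y hy => ?_)
      ?_ z ⟨hz', hzs⟩)
    · rw [map_sub]
      exact (hf ⟨z, hz⟩ y hy.1).sub (hf s y hy.2)
    · rw [hfw ⟨z, hz⟩ _ ⟨h2, hxE⟩, hfw s _ ⟨h1, hxE⟩, sub_self]
  refine ⟨fun z => if hz : z ∈ Ω then f ⟨z, hz⟩ z else 0, fun z hz => ?_, fun z hz => ?_⟩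
  · have hzz := self_mem_halfStrip z (hε ⟨z, hz⟩)
    simp only [hz, dif_pos]
    refine (hf ⟨z, hz⟩ z hzz).congr_of_eventuallyEq ?_
    filter_upwards [(isOpen_halfStrip z (ε ⟨z, hz⟩)).mem_nhds hzz] with y hy
    simp only [hsub ⟨z, hz⟩ hy, dif_pos]
    exact hW ⟨z, hz⟩ y _ hy
  · simp only [h.core_subset hz, dif_pos]
    exact hfw _ _ ⟨self_mem_halfStrip z (hε _), hz⟩

end IsRightwardDomain


/-! ### Branches of the logarithm -/

open scoped ComplexOrder in
-- The cut of `logBranch φ` is the ray opposite to the direction φ. So φ = θ'_i cuts from t'_i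
-- towards η₀, while φ = θ'_∞ + π cuts along the ray of the cut plane.
theorem mul_exp_neg_mem_slitPlane_iff (φ : ℝ) (z : ℂ) :
    z * Complex.exp (-(φ * Complex.I)) ∈ Complex.slitPlane ↔
      ∀ s : ℝ, 0 ≤ s → z ≠ -(s * Complex.exp (φ * Complex.I)) := by
  rw [Complex.mem_slitPlane_iff_not_le_zero]
  constructor
  · rintro h s hs rfl
    apply h
    rw [neg_mul, mul_assoc, ← Complex.exp_add, add_neg_cancel, Complex.exp_zero, mul_one]
    rw [neg_nonpos]
    exact_mod_cast hs
  · intro h hle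
    obtain ⟨h1, h2⟩ := Complex.le_def.1 hle
    refine h (-(z * Complex.exp (-(φ * Complex.I))).re) (by simpa using h1) ?_
    have h3 : z * Complex.exp (-(φ * Complex.I)) =
        ((z * Complex.exp (-(φ * Complex.I))).re : ℂ) := by
      apply Complex.ext
      · simp
      · simpa using h2
    rw [Complex.ofReal_neg, neg_mul, neg_neg, ← h3, mul_assoc, ← Complex.exp_add,
      neg_add_cancel, Complex.exp_zero, mul_one]

namespace OkuboData

theorem exp_logBranch (φ : ℝ) {z : ℂ} (hz : z ≠ 0) : Complex.exp (logBranch φ z) = z := by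
  rw [logBranch, Complex.exp_add, Complex.exp_log (mul_ne_zero hz (Complex.exp_ne_zero _)),
    mul_assoc, ← Complex.exp_add, neg_add_cancel, Complex.exp_zero, mul_one]

theorem logBranch_im (φ : ℝ) (z : ℂ) :
    (logBranch φ z).im = (Complex.log (z * Complex.exp (-(φ * Complex.I)))).im + φ := by
  simp [logBranch]

theorem logBranch_re (φ : ℝ) (z : ℂ) : (logBranch φ z).re = Real.log ‖z‖ := by
  have : ‖Complex.exp (-(φ * Complex.I))‖ = 1 := by
    rw [← neg_mul, ← Complex.ofReal_neg, Complex.norm_exp_ofReal_mul_I]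
  simp [logBranch, Complex.log_re, this]

theorem hasDerivAt_logBranch (φ : ℝ) {z : ℂ}
    (hz : z * Complex.exp (-(φ * Complex.I)) ∈ Complex.slitPlane) :
    HasDerivAt (logBranch φ) z⁻¹ z := by
  have h1 := (((hasDerivAt_id z).mul_const (Complex.exp (-(φ * Complex.I)))).clog hz).add_const
    (φ * Complex.I)
  convert! h1 using 1
  have h2 := Complex.exp_ne_zero (-(φ * Complex.I))
  have h3 : z ≠ 0 := left_ne_zero_of_mul (Complex.slitPlane_ne_zero hz)
  simp only [id]
  field_simp

theorem logBranch_exp {φ : ℝ} {s : ℂ} (h1 : φ - Real.pi < s.im) (h2 : s.im ≤ φ + Real.pi) :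
    logBranch φ (Complex.exp s) = s := by
  rw [logBranch, ← Complex.exp_add, Complex.log_exp]
  · ring
  · simp; linarith
  · simp; linarith

/-! ### The cut plane in the coordinate log(ζ - η₀) -/

variable (D : OkuboData) (η₀ : ℂ)

/-- The modulus of `t'_i - η₀`. -/
def rad (i : Fin D.p) : ℝ := ‖D.t i.castSucc - D.t (Fin.last D.p)‖⁻¹

theorem rad_pos (i : Fin D.p) : 0 < D.rad i := by
  refine inv_pos.2 (norm_pos_iff.2 (sub_ne_zero.2 fun h => ?_))
  exact (Fin.castSucc_lt_last i).ne (D.t_injective h)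

theorem t'_sub (i : Fin D.p) :
    D.t' η₀ i - η₀ = D.rad i * Complex.exp (D.θ' i * Complex.I) := by
  rw [t', add_sub_cancel_left, D.θ_arg i, rad, θ']
  simp only [Complex.ofReal_neg, neg_mul, Complex.exp_neg, Complex.ofReal_inv, one_div, mul_inv]

theorem norm_t'_sub (i : Fin D.p) : ‖D.t' η₀ i - η₀‖ = D.rad i := by
  rw [t'_sub, norm_mul, Complex.norm_exp_ofReal_mul_I, mul_one, Complex.norm_real,
    Real.norm_of_nonneg (D.rad_pos i).le]

theorem θ'inf_lt (i : Fin D.p) : D.θ'inf < D.θ' i :=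
  neg_lt_neg (D.θ_strictMono (Fin.castSucc_lt_last i))

theorem θ'_lt (i : Fin D.p) : D.θ' i < D.θ'inf + 2 * Real.pi := by
  have h1 := D.θ_lt
  have h2 : D.θ 0 ≤ D.θ i.castSucc := D.θ_strictMono.monotone (Fin.zero_le _)
  simp only [θ', θ'inf]
  linarith

theorem θ'_injective : Function.Injective D.θ' := fun _ _ h =>
  Fin.castSucc_injective _ (D.θ_strictMono.injective (neg_injective h))

/-- The image of the cut plane under the branch of `log (ζ - η₀)` with imaginary part in
`(θ'_∞, θ'_∞ + 2π)`. -/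
def logDomain : Set ℂ :=
  {s | D.θ'inf < s.im ∧ s.im < D.θ'inf + 2 * Real.pi ∧
    ∀ i, s.im = D.θ' i → Real.log (D.rad i) < s.re}

/-- The image of the part of the cut plane outside the circle containing all `t'_i`. -/
def logCore : Set ℂ :=
  {s | D.θ'inf < s.im ∧ s.im < D.θ'inf + 2 * Real.pi ∧ ∀ i, Real.log (D.rad i) < s.re}

theorem exists_log_rad_lt : ∃ x : ℝ, ∀ i, Real.log (D.rad i) < x := by
  obtain ⟨x, hx⟩ := (Set.finite_range fun i => Real.log (D.rad i)).bddAbove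
  exact ⟨x + 1, fun i => (hx (Set.mem_range_self i)).trans_lt (lt_add_one x)⟩

theorem isRightwardDomain : IsRightwardDomain D.logDomain D.logCore where
  isOpen_core := by
    have : D.logCore = {s | D.θ'inf < s.im} ∩ ({s | s.im < D.θ'inf + 2 * Real.pi} ∩
        ⋂ i, {s | Real.log (D.rad i) < s.re}) := by
      ext s; simp [logCore]
    rw [this]
    exact (isOpen_lt continuous_const Complex.continuous_im).inter
      ((isOpen_lt Complex.continuous_im continuous_const).inter
        (isOpen_iInter_of_finite fun i => isOpen_lt continuous_const Complex.continuous_re))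
  convex_core := by
    have : D.logCore = {s | D.θ'inf < s.im} ∩ ({s | s.im < D.θ'inf + 2 * Real.pi} ∩
        ⋂ i, {s | Real.log (D.rad i) < s.re}) := by
      ext s; simp [logCore]
    rw [this]
    exact (convex_halfSpace_im_gt _).inter ((convex_halfSpace_im_lt _).inter
      (convex_iInter fun i => convex_halfSpace_re_gt _))
  core_subset := fun s hs => ⟨hs.1, hs.2.1, fun i _ => hs.2.2 i⟩
  exists_halfStrip := by
    rintro s ⟨h1, h2, h3⟩
    -- If s lies on the line of the i-th cut, the half-strip starts no further left than the end of
    -- that cut; otherwise it is thin enough to miss the line.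
    have key : ∀ i, ∃ ε > 0, ∀ z ∈ halfStrip s ε, z.im = D.θ' i → Real.log (D.rad i) < z.re := by
      intro i
      by_cases hi : s.im = D.θ' i
      · refine ⟨s.re - Real.log (D.rad i), sub_pos.2 (h3 i hi), fun z hz _ => ?_⟩
        linarith [hz.1]
      · refine ⟨|s.im - D.θ' i|, abs_pos.2 (sub_ne_zero.2 hi), fun z hz hzi => ?_⟩
        have := hz.2
        rw [hzi, abs_sub_comm] at this
        exact absurd this (lt_irrefl _)
    choose ε hε hεz using key
    obtain ⟨δ, hδ, hδε⟩ : ∃ δ > 0, ∀ i, δ ≤ ε i := by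
      rcases isEmpty_or_nonempty (Fin D.p) with h | h
      · exact ⟨1, one_pos, fun i => h.elim i⟩
      · obtain ⟨i, hi⟩ := Finite.exists_min ε
        exact ⟨ε i, hε i, hi⟩
    refine ⟨min δ (min (s.im - D.θ'inf) (D.θ'inf + 2 * Real.pi - s.im)), ?_, ?_⟩
    · exact lt_min hδ (lt_min (by linarith) (by linarith))
    · intro z hz
      have hz2 := hz.2
      rw [lt_min_iff, lt_min_iff, abs_lt, abs_lt, abs_lt] at hz2
      refine ⟨by linarith [hz2.2.1.1], by linarith [hz2.2.2.2], fun i hi => hεz i z ⟨?_, ?_⟩ hi⟩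
      · have := hz.1
        have h4 := (min_le_left δ (min (s.im - D.θ'inf) (D.θ'inf + 2 * Real.pi - s.im))).trans
          (hδε i)
        linarith
      · exact hz.2.trans_le ((min_le_left _ _).trans (hδε i))
  exists_add_mem_core := by
    rintro s ⟨h1, h2, -⟩
    obtain ⟨x, hx⟩ := D.exists_log_rad_lt
    refine ⟨|x - s.re|, abs_nonneg _, by simpa using h1, by simpa using h2, fun i => ?_⟩
    have := hx i
    have := le_abs_self (x - s.re)
    simp only [Complex.add_re, Complex.ofReal_re]
    linarith

theorem ne_t'_of_mem {ζ : ℂ} (hζ : ζ ∈ D.cutPlane η₀) (i : Fin D.p) : ζ ≠ D.t' η₀ i := by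
  have := hζ.1 i 1 zero_le_one le_rfl
  simpa using this

theorem ne_center_of_mem {ζ : ℂ} (hζ : ζ ∈ D.cutPlane η₀) : ζ ≠ η₀ := by
  have := hζ.2 0 le_rfl
  simpa using this

theorem not_mem_ray_iff (ζ : ℂ) :
    (∀ s : ℝ, 0 ≤ s → ζ ≠ η₀ + s * Complex.exp (D.θ'inf * Complex.I)) ↔
      (ζ - η₀) * Complex.exp (-(((D.θ'inf + Real.pi : ℝ) : ℂ) * Complex.I)) ∈
        Complex.slitPlane := by
  rw [mul_exp_neg_mem_slitPlane_iff]
  refine forall₂_congr fun s _ => not_congr ?_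
  rw [Complex.ofReal_add, add_mul, Complex.exp_add, Complex.exp_pi_mul_I, sub_eq_iff_eq_add']
  simp

/-- The branch of `log (ζ - η₀)` on the cut plane. -/
def logCut (ζ : ℂ) : ℂ := logBranch (D.θ'inf + Real.pi) (ζ - η₀)

variable {D η₀}

theorem exp_logCut {ζ : ℂ} (hζ : ζ ∈ D.cutPlane η₀) :
    Complex.exp (D.logCut η₀ ζ) = ζ - η₀ :=
  exp_logBranch _ (sub_ne_zero.2 (D.ne_center_of_mem η₀ hζ))

theorem hasDerivAt_logCut {ζ : ℂ} (hζ : ζ ∈ D.cutPlane η₀) :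
    HasDerivAt (D.logCut η₀) (ζ - η₀)⁻¹ ζ :=
  (hasDerivAt_logBranch _ ((D.not_mem_ray_iff η₀ ζ).1 hζ.2)).comp_sub_const ζ η₀

theorem logCut_add_exp {s : ℂ} (h1 : D.θ'inf < s.im) (h2 : s.im < D.θ'inf + 2 * Real.pi) :
    D.logCut η₀ (η₀ + Complex.exp s) = s := by
  rw [logCut, add_sub_cancel_left, logBranch_exp] <;> linarith

theorem logCut_im_mem {ζ : ℂ} (hζ : ζ ∈ D.cutPlane η₀) :
    D.θ'inf < (D.logCut η₀ ζ).im ∧ (D.logCut η₀ ζ).im < D.θ'inf + 2 * Real.pi := by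
  have h := (D.not_mem_ray_iff η₀ ζ).1 hζ.2
  have h1 := Complex.neg_pi_lt_arg
    ((ζ - η₀) * Complex.exp (-(((D.θ'inf + Real.pi : ℝ) : ℂ) * Complex.I)))
  have h2 := (Complex.arg_le_pi
    ((ζ - η₀) * Complex.exp (-(((D.θ'inf + Real.pi : ℝ) : ℂ) * Complex.I)))).lt_of_ne
      (Complex.mem_slitPlane_iff_arg.1 h).1
  rw [logCut, logBranch_im, Complex.log_im]
  constructor <;> linarith

theorem exp_mul_mem_slitPlane {s : ℂ} (h1 : D.θ'inf < s.im)
    (h2 : s.im < D.θ'inf + 2 * Real.pi) :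
    Complex.exp s * Complex.exp (-(((D.θ'inf + Real.pi : ℝ) : ℂ) * Complex.I)) ∈
      Complex.slitPlane := by
  rw [Complex.mem_slitPlane_iff_arg, ← Complex.exp_add, Complex.arg_exp]
  refine ⟨?_, Complex.exp_ne_zero _⟩
  rw [(toIocMod_eq_self _).2]
  · intro h
    simp at h
    linarith
  · constructor
    · simp; linarith
    · simp; linarith

theorem add_exp_mem_cutPlane {s : ℂ} (hs : s ∈ D.logDomain) :
    η₀ + Complex.exp s ∈ D.cutPlane η₀ := by
  obtain ⟨h1, h2, h3⟩ := hs
  constructor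
  · intro i σ h0 hσ1 heq
    rw [add_right_inj, D.t'_sub] at heq
    have hσ : 0 < σ := h0.lt_of_ne (by
      rintro rfl
      simp at heq)
    have h4 : Complex.exp s = Complex.exp (Real.log (D.rad i * σ) + D.θ' i * Complex.I) := by
      rw [heq, Complex.exp_add, ← Complex.ofReal_exp,
        Real.exp_log (mul_pos (D.rad_pos i) hσ)]
      push_cast
      ring
    have h5 := congrArg (D.logCut η₀) (congrArg (η₀ + ·) h4)
    rw [logCut_add_exp h1 h2, logCut_add_exp (by simpa using D.θ'inf_lt i)
      (by simpa using D.θ'_lt i)] at h5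
    have h6 := h3 i (by simp [h5])
    rw [h5] at h6
    simp only [Complex.add_re, Complex.ofReal_re, Complex.mul_re, Complex.I_re, mul_zero,
      Complex.ofReal_im, Complex.I_im, mul_one, sub_self, add_zero] at h6
    rw [Real.log_lt_log_iff (D.rad_pos i) (mul_pos (D.rad_pos i) hσ)] at h6
    have := D.rad_pos i
    nlinarith
  · rw [not_mem_ray_iff, add_sub_cancel_left]
    exact exp_mul_mem_slitPlane h1 h2

theorem logCut_mem {ζ : ℂ} (hζ : ζ ∈ D.cutPlane η₀) : D.logCut η₀ ζ ∈ D.logDomain := by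
  obtain ⟨h1, h2⟩ := logCut_im_mem hζ
  refine ⟨h1, h2, fun i hi => ?_⟩
  by_contra! hle
  have hexp := exp_logCut hζ
  refine hζ.1 i (Real.exp ((D.logCut η₀ ζ).re - Real.log (D.rad i))) (Real.exp_pos _).le
    (Real.exp_le_one_iff.2 (by linarith)) ?_
  rw [← sub_eq_iff_eq_add', ← hexp, D.t'_sub, Real.exp_sub, Real.exp_log (D.rad_pos i)]
  conv_lhs => rw [← Complex.re_add_im (D.logCut η₀ ζ), Complex.exp_add, hi]
  have : (D.rad i : ℂ) ≠ 0 := by exact_mod_cast (D.rad_pos i).ne'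
  push_cast
  field_simp

theorem logCut_mem_core {ζ : ℂ} (hζ : ζ ∈ D.cutPlane η₀)
    (h : ∀ j, ‖D.t' η₀ j - η₀‖ < ‖ζ - η₀‖) : D.logCut η₀ ζ ∈ D.logCore := by
  obtain ⟨h1, h2⟩ := logCut_im_mem hζ
  refine ⟨h1, h2, fun i => ?_⟩
  rw [logCut, logBranch_re]
  refine Real.log_lt_log (D.rad_pos i) ?_
  rw [← D.norm_t'_sub η₀]
  exact h i

variable (D η₀)

/-! ### The underlying system as a vector field -/

/-- `w ↦ (ζ I - T')⁻¹ (ρ I + A) w`. -/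
def coeffField (ρ ζ : ℂ) : (D.Row → ℂ) →L[ℂ] (D.Row → ℂ) :=
  ∑ a : D.Row, (ζ - D.t' η₀ a.1)⁻¹ •
    (LinearMap.toContinuousLinearMap (LinearMap.single ℂ (fun _ : D.Row => ℂ) a ∘ₗ
      LinearMap.proj a ∘ₗ (ρ • (1 : Matrix D.Row D.Row ℂ) + D.A).mulVecLin))

theorem coeffField_apply (ρ ζ : ℂ) (v : D.Row → ℂ) (a : D.Row) :
    D.coeffField η₀ ρ ζ v a =
      (ζ - D.t' η₀ a.1)⁻¹ * ((ρ • (1 : Matrix D.Row D.Row ℂ) + D.A) *ᵥ v) a := by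
  simp [coeffField, Finset.sum_apply, Pi.single_apply, Matrix.add_mulVec, Matrix.smul_mulVec]

theorem differentiableOn_coeffField (ρ : ℂ) {S : Set ℂ} (hS : ∀ ζ ∈ S, ∀ i, ζ ≠ D.t' η₀ i) :
    DifferentiableOn ℂ (D.coeffField η₀ ρ) S := by
  unfold coeffField
  refine DifferentiableOn.fun_sum fun a _ => DifferentiableOn.smul_const ?_ _
  exact (differentiableOn_id.sub_const _).inv fun ζ hζ => sub_ne_zero.2 (hS ζ hζ _)

variable {D η₀}

theorem isSolutionOn_iff {ρ : ℂ} {S : Set ℂ} (hS : ∀ ζ ∈ S, ∀ i, ζ ≠ D.t' η₀ i)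
    {w : ℂ → D.Row → ℂ} :
    D.IsSolutionOn η₀ ρ S w ↔ ∀ ζ ∈ S, HasDerivAt w (D.coeffField η₀ ρ ζ (w ζ)) ζ := by
  refine forall₂_congr fun ζ hζ => ?_
  have key : ∀ v : D.Row → ℂ,
      (ζ • (1 : Matrix D.Row D.Row ℂ) - D.T' η₀) *ᵥ v =
        (ρ • (1 : Matrix D.Row D.Row ℂ) + D.A) *ᵥ w ζ ↔ v = D.coeffField η₀ ρ ζ (w ζ) := by
    intro v
    rw [funext_iff, funext_iff]
    refine forall_congr' fun a => ?_
    rw [coeffField_apply, Matrix.sub_mulVec, Matrix.smul_mulVec, Matrix.one_mulVec, T']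
    rw [eq_inv_mul_iff_mul_eq₀ (sub_ne_zero.2 (hS ζ hζ a.1))]
    simp [Matrix.mulVec_diagonal, sub_mul]
  rw [key]
  constructor
  · rintro ⟨h1, h2⟩
    rw [← h2]
    exact h1.hasDerivAt
  · intro h
    exact ⟨h.differentiableAt, h.deriv⟩

variable (D η₀)

/-- The underlying system in the variable `log (ζ - η₀)`. -/
def logField (ρ s : ℂ) : (D.Row → ℂ) →L[ℂ] (D.Row → ℂ) :=
  Complex.exp s • D.coeffField η₀ ρ (η₀ + Complex.exp s)

theorem differentiableOn_logField (ρ : ℂ) :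
    DifferentiableOn ℂ (D.logField η₀ ρ) D.logDomain := by
  refine Complex.differentiable_exp.differentiableOn.smul ?_
  exact (D.differentiableOn_coeffField η₀ ρ (S := D.cutPlane η₀)
    fun ζ hζ => D.ne_t'_of_mem η₀ hζ).comp
    (Complex.differentiable_exp.const_add η₀).differentiableOn
    fun s hs => add_exp_mem_cutPlane hs

variable {D η₀}

theorem IsSolutionOn.hasDerivAt_log {ρ : ℂ} {w : ℂ → D.Row → ℂ}
    (hw : D.IsSolutionOn η₀ ρ (D.cutPlane η₀) w) {s : ℂ} (hs : s ∈ D.logDomain) :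
    HasDerivAt (fun s => w (η₀ + Complex.exp s))
      (D.logField η₀ ρ s (w (η₀ + Complex.exp s))) s :=
  ((isSolutionOn_iff fun _ h => D.ne_t'_of_mem η₀ h).1 hw _ (add_exp_mem_cutPlane hs)).scomp s
    ((Complex.hasDerivAt_exp s).const_add η₀)

theorem isSolutionOn_comp_logCut {ρ : ℂ} {W : ℂ → D.Row → ℂ}
    (hW : ∀ s ∈ D.logDomain, HasDerivAt W (D.logField η₀ ρ s (W s)) s) :
    D.IsSolutionOn η₀ ρ (D.cutPlane η₀) (fun ζ => W (D.logCut η₀ ζ)) := by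
  refine (isSolutionOn_iff fun _ h => D.ne_t'_of_mem η₀ h).2 fun ζ hζ => ?_
  convert! (hW _ (logCut_mem hζ)).scomp ζ (hasDerivAt_logCut hζ) using 1
  rw [logField, exp_logCut hζ, add_sub_cancel, smul_apply, smul_smul,
    inv_mul_cancel₀ (sub_ne_zero.2 (D.ne_center_of_mem η₀ hζ)), one_smul]

theorem IsSolutionOn.eq_zero {ρ : ℂ} {w : ℂ → D.Row → ℂ}
    (hw : D.IsSolutionOn η₀ ρ (D.cutPlane η₀) w) {ζ₀ : ℂ} (hζ₀ : ζ₀ ∈ D.cutPlane η₀)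
    (h0 : w ζ₀ = 0) : ∀ ζ ∈ D.cutPlane η₀, w ζ = 0 := by
  intro ζ hζ
  have := D.isRightwardDomain.eq_zero (D.differentiableOn_logField η₀ ρ).continuousOn
    (fun s hs => hw.hasDerivAt_log hs) (logCut_mem hζ₀)
    (by simpa [exp_logCut hζ₀] using h0) _ (logCut_mem hζ)
  simpa [exp_logCut hζ] using this

theorem exists_isSolutionOn_extending {ρ : ℂ} {W : ℂ → D.Row → ℂ}
    (hW : ∀ s ∈ D.logCore, HasDerivAt W (D.logField η₀ ρ s (W s)) s) :
    ∃ w : ℂ → D.Row → ℂ, D.IsSolutionOn η₀ ρ (D.cutPlane η₀) w ∧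
      ∀ ζ ∈ D.cutPlane η₀, D.logCut η₀ ζ ∈ D.logCore → w ζ = W (D.logCut η₀ ζ) := by
  obtain ⟨W', h1, h2⟩ := D.isRightwardDomain.exists_extension
    (D.differentiableOn_logField η₀ ρ) hW
  exact ⟨_, isSolutionOn_comp_logCut h1, fun ζ _ h => h2 _ h⟩

/-- Uniqueness for the equation with zero coefficient, which stands in for connectedness of the cut
plane. -/
theorem eq_of_hasDerivAt_zero {F : ℂ → ℂ} (hF : ∀ ζ ∈ D.cutPlane η₀, HasDerivAt F 0 ζ)
    {ζ₁ ζ₂ : ℂ} (h₁ : ζ₁ ∈ D.cutPlane η₀) (h₂ : ζ₂ ∈ D.cutPlane η₀) : F ζ₁ = F ζ₂ := by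
  have := D.isRightwardDomain.eq_zero (B := fun _ => (0 : ℂ →L[ℂ] ℂ)) continuousOn_const
    (w := fun s => F (η₀ + Complex.exp s) - F ζ₂)
    (fun s hs => by
      simpa using ((hF _ (add_exp_mem_cutPlane hs)).comp s
        ((Complex.hasDerivAt_exp s).const_add η₀)).sub_const (F ζ₂)) (logCut_mem h₂)
    (by simp [exp_logCut h₂]) _ (logCut_mem h₁)
  simpa [exp_logCut h₁, sub_eq_zero] using this

end OkuboData


/-! ### From formal to convergent series solutions -/

/-- A formal solution at infinity of `(1 - x S) (β - x d/dx) h = A h`, `x` being the inverse of the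
coordinate, is an actual solution where it converges. -/
theorem hasDerivAt_of_recurrence_infinity {V : Type*} [NormedAddCommGroup V] [NormedSpace ℂ V]
    [CompleteSpace V] {S A : V →L[ℂ] V} {b : ℕ → V} {β : ℂ} (h0 : β • b 0 = A (b 0))
    (hb : ∀ m : ℕ, (β - (m + 1)) • b (m + 1) - A (b (m + 1)) = (β - m) • S (b m)) {x y : ℂ}
    (hs : Summable fun m => y ^ m • b m) (hx : ‖x‖ < ‖y‖) :
    ∃ h' : V, HasDerivAt (fun z => ∑' m, z ^ m • b m) h' x ∧
      (β • (∑' m, x ^ m • b m) - x • h') - x • S (β • (∑' m, x ^ m • b m) - x • h') =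
        A (∑' m, x ^ m • b m) := by
  obtain ⟨h', hd, he⟩ := hasSum_euler hs hx
  have s0 := (summable_and_hasDerivAt_tsum_pow_smul hs hx).1.hasSum
  refine ⟨h', hd, ?_⟩
  set h := ∑' m, x ^ m • b m
  have h1 := (s0.const_smul β).sub he
  have h2 := (h1.mapL S).const_smul x
  have h3 := h1.sub (s0.mapL A)
  -- Multiplication by x shifts the index, so the series is compared from its term 1 on; its term 0
  -- vanishes by `h0`.
  have h4 := (hasSum_nat_add_iff' 1).2 h3
  have h5 := h4.unique (h2.congr_fun fun m => ?_)
  · rw [← h5]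
    simp [h0]
  · have h6 := congrArg (fun v => x ^ (m + 1) • v) (hb m)
    simp only [smul_sub, sub_smul, map_sub, map_smul, smul_smul] at h6 ⊢
    push_cast at h6 ⊢
    convert h6 using 1 <;> module

/-- A formal solution at the origin of `(x - S) (α + x d/dx) h = x A h` is an actual solution where
it converges. -/
theorem hasDerivAt_of_recurrence_origin {V : Type*} [NormedAddCommGroup V] [NormedSpace ℂ V]
    [CompleteSpace V] {S A : V →L[ℂ] V} {b : ℕ → V} {α : ℂ} (h0 : S (b 0) = 0)
    (hb : ∀ m : ℕ, (α + m) • b m - A (b m) = (α + (m + 1)) • S (b (m + 1))) {x y : ℂ}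
    (hs : Summable fun m => y ^ m • b m) (hx : ‖x‖ < ‖y‖) :
    ∃ h' : V, HasDerivAt (fun z => ∑' m, z ^ m • b m) h' x ∧
      x • (α • (∑' m, x ^ m • b m) + x • h') - S (α • (∑' m, x ^ m • b m) + x • h') =
        x • A (∑' m, x ^ m • b m) := by
  obtain ⟨h', hd, he⟩ := hasSum_euler hs hx
  have s0 := (summable_and_hasDerivAt_tsum_pow_smul hs hx).1.hasSum
  refine ⟨h', hd, ?_⟩
  set h := ∑' m, x ^ m • b m
  have h1 := (s0.const_smul α).add he
  have h2 := (hasSum_nat_add_iff' 1).2 (h1.mapL S)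
  have h3 := (h1.const_smul x).sub ((s0.mapL A).const_smul x)
  have h5 := h3.unique (h2.congr_fun fun m => ?_)
  · simp only [Finset.range_one, Finset.sum_singleton, pow_zero, one_smul, Nat.cast_zero,
      zero_mul, zero_smul, add_zero, map_smul, h0, smul_zero, sub_zero] at h5
    rw [← h5, sub_sub_cancel]
  · have h6 := congrArg (fun v => x ^ (m + 1) • v) (hb m)
    simp only [smul_sub, smul_add, add_smul, map_add, map_smul, smul_smul] at h6 ⊢
    push_cast at h6 ⊢
    convert h6 using 1 <;> module

theorem exists_lt_norm_of_forall_mul_lt {ι : Type*} [Finite ι] {c : ι → ℝ} {r : ℝ}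
    (h : ∀ i, c i * r < 1) : ∃ r', r < r' ∧ ∀ i, c i * r' < 1 := by
  have h1 : ∀ᶠ r' in 𝓝[>] r, ∀ i, c i * r' < 1 := by
    rw [Filter.eventually_all]
    intro i
    refine Filter.Eventually.filter_mono nhdsWithin_le_nhds ?_
    exact (continuous_const.mul continuous_id).continuousAt.eventually_lt continuousAt_const (h i)
  obtain ⟨r', h2, h3⟩ := (h1.and self_mem_nhdsWithin).exists
  exact ⟨r', h3, h2⟩

/-- The continuous linear map given by a square matrix. -/
def matL {n : Type*} [Fintype n] [DecidableEq n] (M : Matrix n n ℂ) : (n → ℂ) →L[ℂ] (n → ℂ) :=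
  LinearMap.toContinuousLinearMap M.mulVecLin

@[simp] theorem matL_apply {n : Type*} [Fintype n] [DecidableEq n] (M : Matrix n n ℂ)
    (v : n → ℂ) : matL M v = M *ᵥ v := rfl

namespace OkuboData

variable {D : OkuboData} {η₀ : ℂ}

/-! ### Solutions at infinity: expansion and existence -/

theorem norm_exp_neg_of_mem_logCore {s : ℂ} (hs : s ∈ D.logCore) (i : Fin D.p) :
    D.rad i * ‖Complex.exp (-s)‖ < 1 := by
  rw [Complex.norm_exp, Complex.neg_re, ← Real.exp_log (D.rad_pos i), ← Real.exp_add,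
    Real.exp_lt_one_iff]
  linarith [hs.2.2 i]

theorem exists_mem_logCore {r : ℝ} (hr0 : 0 < r) (hr : ∀ i, D.rad i * r < 1) :
    ∃ s ∈ D.logCore, ‖Complex.exp (-s)‖ = r := by
  refine ⟨-Real.log r + (D.θ'inf + Real.pi : ℝ) * Complex.I, ⟨?_, ?_, fun i => ?_⟩, ?_⟩
  · simp; exact Real.pi_pos
  · simp; linarith [Real.pi_pos]
  · have h1 := Real.log_lt_log (mul_pos (D.rad_pos i) hr0) (hr i)
    rw [Real.log_mul (D.rad_pos i).ne' hr0.ne', Real.log_one] at h1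
    simp
    linarith
  · rw [Complex.norm_exp]
    simp [Real.exp_log hr0]

theorem one_div_eq_exp_neg_logCut {ζ : ℂ} (hζ : ζ ∈ D.cutPlane η₀) :
    1 / (ζ - η₀) = Complex.exp (-D.logCut η₀ ζ) := by
  rw [Complex.exp_neg, exp_logCut hζ, one_div]

theorem logCut_exp_of_mem_core {s : ℂ} (hs : s ∈ D.logCore) :
    D.logCut η₀ (η₀ + Complex.exp s) = s := logCut_add_exp hs.1 hs.2.1

theorem far_of_mem_core {s : ℂ} (hs : s ∈ D.logCore) (j : Fin D.p) :
    ‖D.t' η₀ j - η₀‖ < ‖η₀ + Complex.exp s - η₀‖ := by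
  rw [D.norm_t'_sub, add_sub_cancel_left, Complex.norm_exp, ← Real.exp_log (D.rad_pos j)]
  exact Real.exp_lt_exp.2 (hs.2.2 j)

/-- The expansion at infinity, as a holomorphic function of `1 / (ζ - η₀)`. -/
theorem IsInfinitySolution.exists_expansion {ρ : ℂ} {b : D.Eig} {w : ℂ → D.Row → ℂ}
    (hw : D.IsInfinitySolution η₀ ρ b w) (hΓ : Complex.Gamma (-ρ - D.mu b.1) ≠ 0) :
    ∃ h : ℂ → D.Row → ℂ, (∀ x, (∀ i, D.rad i * ‖x‖ < 1) → DifferentiableAt ℂ h x) ∧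
      h 0 = D.P *ᵥ Pi.single b 1 ∧
      ∀ s ∈ D.logCore, w (η₀ + Complex.exp s) =
        Complex.exp ((ρ + D.mu b.1) * s) • h (Complex.exp (-s)) := by
  obtain ⟨-, g, hg0, hg⟩ := hw
  set β := ρ + D.mu b.1
  set c : ℕ → D.Row → ℂ := fun m =>
    (Complex.Gamma (-ρ - D.mu b.1 + m) / Complex.Gamma (-ρ - D.mu b.1)) • g m with hc
  have hsum : ∀ s ∈ D.logCore, HasSum (fun m : ℕ => Complex.exp (-s) ^ m • c m)
      (Complex.exp (-(β * s)) • w (η₀ + Complex.exp s)) := by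
    intro s hs
    have hcut := add_exp_mem_cutPlane (η₀ := η₀) (D.isRightwardDomain.core_subset hs)
    have h1 := (hg _ hcut (far_of_mem_core hs)).const_smul (Complex.exp (-(β * s)))
    refine h1.congr_fun fun m => ?_
    have h2 : logBranch (D.θ'inf + Real.pi) (η₀ + Complex.exp s - η₀) = s :=
      logCut_exp_of_mem_core hs
    rw [h2, add_sub_cancel_left, hc, smul_smul, smul_smul, Complex.exp_neg s, one_div,
      Complex.exp_neg]
    congr 1
    have := Complex.exp_ne_zero (β * s)
    field_simp
  refine ⟨fun x => ∑' m, x ^ m • c m, fun x hx => ?_, ?_, fun s hs => ?_⟩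
  · obtain ⟨r, hxr, hr⟩ := exists_lt_norm_of_forall_mul_lt hx
    obtain ⟨s, hs, hsr⟩ := exists_mem_logCore ((norm_nonneg x).trans_lt hxr) hr
    exact (summable_and_hasDerivAt_tsum_pow_smul (hsum s hs).summable
      (by rwa [hsr])).2.2.differentiableAt
  · show ∑' m : ℕ, (0 : ℂ) ^ m • c m = _
    rw [tsum_eq_single 0 fun m hm => by simp [hm]]
    -- The Gamma quotient at m = 0 is 1 because Γ is nonzero here; at a pole the default values
    -- would make it 0.
    simp [hc, hg0, div_self hΓ]
  · show _ = Complex.exp (β * s) • ∑' m, Complex.exp (-s) ^ m • c m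
    rw [(hsum s hs).tsum_eq, smul_smul, ← Complex.exp_add]
    simp [β]

theorem A_mulVec_P_mulVec (v : D.Eig → ℂ) :
    D.A *ᵥ (D.P *ᵥ v) = D.P *ᵥ (fun b => D.mu b.1 * v b) := by
  rw [Matrix.mulVec_mulVec, D.A_mul_P, ← Matrix.mulVec_mulVec]
  congr 1
  ext b
  rw [Matrix.mulVec_diagonal]

/-- In the eigenbasis of A the operator to be inverted is diagonal with entries μ_b - μ_e - (m + 1):
this is -(m + 1) inside one eigenspace and nonzero by nonresonance otherwise. The coefficients c
absorb the Gamma quotients. -/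
theorem exists_recurrence_infinity (ρ : ℂ) (b : D.Eig) :
    ∃ c : ℕ → D.Row → ℂ, c 0 = D.P *ᵥ Pi.single b 1 ∧
      ∀ m : ℕ, (ρ + D.mu b.1 - (m + 1)) • c (m + 1) -
        (ρ • (1 : Matrix D.Row D.Row ℂ) + D.A) *ᵥ c (m + 1) =
          (ρ + D.mu b.1 - m) • (Matrix.diagonal fun a : D.Row => D.t' η₀ a.1 - η₀) *ᵥ c m := by
  obtain ⟨Q, hPQ, -⟩ := D.P_invertible
  have hstep : ∀ (m : ℕ) (r : D.Row → ℂ), ∃ v : D.Row → ℂ,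
      (ρ + D.mu b.1 - (m + 1)) • v - (ρ • (1 : Matrix D.Row D.Row ℂ) + D.A) *ᵥ v = r := by
    intro m r
    refine ⟨D.P *ᵥ fun e => (D.mu b.1 - D.mu e.1 - (m + 1))⁻¹ * (Q *ᵥ r) e, ?_⟩
    rw [Matrix.add_mulVec, Matrix.smul_mulVec, Matrix.one_mulVec, A_mulVec_P_mulVec,
      ← Matrix.mulVec_smul, ← Matrix.mulVec_smul, ← Matrix.mulVec_add, ← Matrix.mulVec_sub]
    have h1 : r = D.P *ᵥ (Q *ᵥ r) := by rw [Matrix.mulVec_mulVec, hPQ, Matrix.one_mulVec]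
    conv_rhs => rw [h1]
    congr 1
    ext e
    have h2 : D.mu b.1 - D.mu e.1 - (m + 1) ≠ 0 := by
      by_cases hbe : b.1 = e.1
      · rw [hbe, sub_self, zero_sub, neg_ne_zero]
        exact_mod_cast Nat.succ_ne_zero m
      · intro h
        refine D.mu_sub_mu _ _ hbe (m + 1) ?_
        push_cast
        linear_combination h
    simp only [Pi.sub_apply, Pi.add_apply, Pi.smul_apply, smul_eq_mul]
    field_simp
    ring
  choose f hf using hstep
  exact ⟨fun m => Nat.rec (D.P *ᵥ Pi.single b 1) (fun m v => f m ((ρ + D.mu b.1 - m) •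
    (Matrix.diagonal fun a : D.Row => D.t' η₀ a.1 - η₀) *ᵥ v)) m, rfl, fun m => hf m _⟩

theorem norm_diagonal_mulVec_le {n : Type*} [Fintype n] [DecidableEq n] {d : n → ℂ} {R : ℝ}
    (hR : 0 ≤ R) (hd : ∀ a, ‖d a‖ ≤ R) (v : n → ℂ) : ‖Matrix.diagonal d *ᵥ v‖ ≤ R * ‖v‖ := by
  refine (pi_norm_le_iff_of_nonneg (by positivity)).2 fun a => ?_
  rw [Matrix.mulVec_diagonal, norm_mul]
  exact mul_le_mul (hd a) (norm_le_pi_norm v a) (norm_nonneg _) hR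

theorem exists_bound_lt {ι : Type*} [Finite ι] {c : ι → ℝ} {r : ℝ}
    (hc : ∀ i, 0 ≤ c i) (h : ∀ i, c i * r < 1) : ∃ R, 0 ≤ R ∧ (∀ i, c i ≤ R) ∧ R * r < 1 := by
  rcases isEmpty_or_nonempty ι with h' | h'
  · exact ⟨0, le_rfl, fun i => h'.elim i, by simp⟩
  · obtain ⟨i, hi⟩ := Finite.exists_max c
    exact ⟨c i, hc i, hi, h i⟩

theorem summable_of_recurrence_infinity {ρ β : ℂ} {c : ℕ → D.Row → ℂ}
    (hc : ∀ m : ℕ, (β - (m + 1)) • c (m + 1) -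
        (ρ • (1 : Matrix D.Row D.Row ℂ) + D.A) *ᵥ c (m + 1) =
          (β - m) • (Matrix.diagonal fun a : D.Row => D.t' η₀ a.1 - η₀) *ᵥ c m) {x : ℂ}
    (hx : ∀ i, D.rad i * ‖x‖ < 1) : Summable fun m => x ^ m • c m := by
  obtain ⟨R, hR0, hR, hRx⟩ := exists_bound_lt (fun i => (D.rad_pos i).le) hx
  set L := matL (ρ • (1 : Matrix D.Row D.Row ℂ) + D.A)
  refine summable_pow_smul_of_ratio_le (C := ‖β‖ + ‖L‖) hR0 (by positivity) hRx fun m => ?_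
  have h1 : ((m : ℂ) + 1) • c (m + 1) = β • c (m + 1) - L (c (m + 1)) -
      (β - m) • (Matrix.diagonal fun a : D.Row => D.t' η₀ a.1 - η₀) *ᵥ c m := by
    rw [← hc m]
    simp only [L, matL_apply]
    module
  have h2 := congrArg norm h1
  have h3 : ‖(m : ℂ) + 1‖ = m + 1 := by
    rw [← Nat.cast_succ, Complex.norm_natCast, Nat.cast_succ]
  have h4 : ‖β • c (m + 1)‖ = ‖β‖ * ‖c (m + 1)‖ := norm_smul _ _
  have h5 := L.le_opNorm (c (m + 1))
  have h6 : ‖(β - m) • (Matrix.diagonal fun a : D.Row => D.t' η₀ a.1 - η₀) *ᵥ c m‖ ≤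
      (‖β‖ + m) * (R * ‖c m‖) := by
    rw [norm_smul]
    refine mul_le_mul ?_ (norm_diagonal_mulVec_le hR0 (fun a => ?_) _) (norm_nonneg _)
      (by positivity)
    · exact (norm_sub_le _ _).trans (by simp)
    · rw [D.norm_t'_sub]; exact hR _
  rw [norm_smul, h3] at h2
  have h7 := norm_sub_le (β • c (m + 1) - L (c (m + 1)))
    ((β - m) • (Matrix.diagonal fun a : D.Row => D.t' η₀ a.1 - η₀) *ᵥ c m)
  have h8 := norm_sub_le (β • c (m + 1)) (L (c (m + 1)))
  have h9 : 0 ≤ ‖L‖ * (R * ‖c m‖) := by positivity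
  have h10 : 0 ≤ ‖c (m + 1)‖ := norm_nonneg _
  linarith

/-- The series solves the system on the core in the coordinate s, with x = exp(-s), and extends from
there. Nonvanishing of Γ for every m allows passing from c back to the normalized coefficients g. -/
theorem exists_isInfinitySolution (η₀ ρ : ℂ) (b : D.Eig)
    (hΓ : ∀ m : ℕ, Complex.Gamma (-ρ - D.mu b.1 + m) ≠ 0) :
    ∃ w, D.IsInfinitySolution η₀ ρ b w := by
  obtain ⟨c, hc0, hc⟩ := exists_recurrence_infinity (η₀ := η₀) ρ b
  set β := ρ + D.mu b.1 with hβ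
  have hsum : ∀ x : ℂ, (∀ i, D.rad i * ‖x‖ < 1) → Summable fun m => x ^ m • c m := fun x hx =>
    summable_of_recurrence_infinity hc hx
  set S := Matrix.diagonal fun a : D.Row => D.t' η₀ a.1 - η₀ with hS
  set h : ℂ → D.Row → ℂ := fun x => ∑' m, x ^ m • c m with hh
  have h0 : β • c 0 = matL (ρ • (1 : Matrix D.Row D.Row ℂ) + D.A) (c 0) := by
    rw [matL_apply, hc0, Matrix.add_mulVec, A_mulVec_P_mulVec, Matrix.smul_mulVec,
      Matrix.one_mulVec, ← Matrix.mulVec_smul, ← Matrix.mulVec_smul, ← Matrix.mulVec_add]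
    congr 1
    ext e
    by_cases he : e = b
    · subst he; simp [hβ]
    · simp [he]
  have hW : ∀ s ∈ D.logCore,
      HasDerivAt (fun s => Complex.exp (β * s) • h (Complex.exp (-s)))
        (D.logField η₀ ρ s (Complex.exp (β * s) • h (Complex.exp (-s)))) s := by
    intro s hs
    set x := Complex.exp (-s) with hx
    have hxr : ∀ i, D.rad i * ‖x‖ < 1 := norm_exp_neg_of_mem_logCore hs
    obtain ⟨r, hr, hr1⟩ := exists_lt_norm_of_forall_mul_lt hxr
    have hr0 : 0 < r := (norm_nonneg x).trans_lt hr
    have hnr : ‖(r : ℂ)‖ = r := by rw [Complex.norm_real, Real.norm_of_nonneg hr0.le]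
    obtain ⟨h', hd, heq⟩ := hasDerivAt_of_recurrence_infinity (S := matL S) (x := x) (y := r) h0
      (fun m => by simpa using hc m) (hsum r (by rwa [hnr])) (by rwa [hnr])
    have e1 : HasDerivAt (fun s => Complex.exp (-s)) (-x) s := by
      simpa using (hasDerivAt_id s).neg.cexp
    have e2 : HasDerivAt (fun s => Complex.exp (β * s)) (Complex.exp (β * s) * β) s := by
      simpa using ((hasDerivAt_id s).const_mul β).cexp
    convert! e2.smul (hd.scomp s e1) using 1
    have hxs : x * Complex.exp s = 1 := by rw [hx, ← Complex.exp_add]; simp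
    have hcut := add_exp_mem_cutPlane (η₀ := η₀) (D.isRightwardDomain.core_subset hs)
    ext a
    have hne := sub_ne_zero.2 (D.ne_t'_of_mem η₀ hcut a.1)
    have heqa := congrFun heq a
    have hlin : (ρ • (1 : Matrix D.Row D.Row ℂ) + D.A) *ᵥ (Complex.exp (β * s) • h x) =
        Complex.exp (β * s) • (ρ • (1 : Matrix D.Row D.Row ℂ) + D.A) *ᵥ h x :=
      Matrix.mulVec_smul _ _ _
    rw [logField, smul_apply, Pi.smul_apply, coeffField_apply, hlin]
    simp only [matL_apply, S, Pi.sub_apply, Pi.smul_apply, smul_eq_mul,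
      Matrix.mulVec_diagonal] at heqa
    simp only [Pi.add_apply, Pi.smul_apply, smul_eq_mul, Function.comp_apply]
    simp only [hh]
    rw [← heqa]
    field_simp
    linear_combination -(D.t' η₀ a.1 - η₀) * (β * (∑' m, x ^ m • c m) a - x * h' a) * hxs
  obtain ⟨w, hw, hwW⟩ := exists_isSolutionOn_extending hW
  refine ⟨w, hw, fun m => (Complex.Gamma (-ρ - D.mu b.1) / Complex.Gamma (-ρ - D.mu b.1 + m)) • c m,
    ?_, fun ζ hζ hfar => ?_⟩
  · have := hΓ 0
    simp only [Nat.cast_zero, add_zero] at this ⊢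
    rw [div_self this, one_smul, hc0]
  · have hcore := logCut_mem_core hζ hfar
    rw [hwW ζ hζ hcore]
    refine ((hsum _ (norm_exp_neg_of_mem_logCore hcore)).hasSum.const_smul
      (Complex.exp (β * D.logCut η₀ ζ))).congr_fun fun m => ?_
    rw [one_div_eq_exp_neg_logCut hζ, smul_smul, smul_smul]
    congr 1
    have h1 := hΓ m
    have h2 := hΓ 0
    simp only [Nat.cast_zero, add_zero] at h2
    rw [logCut, hβ]
    field_simp

end OkuboData

namespace OkuboData

variable {D : OkuboData} {η₀ : ℂ}

/-! ### The solutions at infinity form a basis -/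

theorem IsSolutionOn.sum {ι : Type*} [Fintype ι] {ρ : ℂ} {w : ι → ℂ → D.Row → ℂ}
    (hw : ∀ b, D.IsSolutionOn η₀ ρ (D.cutPlane η₀) (w b)) (c : ι → ℂ) :
    D.IsSolutionOn η₀ ρ (D.cutPlane η₀) (fun ζ => ∑ b, c b • w b ζ) := by
  have key : ∀ ζ ∈ D.cutPlane η₀, ∀ i, ζ ≠ D.t' η₀ i := fun ζ h => D.ne_t'_of_mem η₀ h
  rw [isSolutionOn_iff key]
  intro ζ hζ
  rw [map_sum]
  refine HasDerivAt.fun_sum fun b _ => ?_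
  rw [map_smul]
  exact ((isSolutionOn_iff key).1 (hw b) ζ hζ).const_smul (c b)

/-- Once the powers are split off, the matrix of the expansions is continuous at x = 0 with value P.
It is thus invertible for small x, and a relation at a single far point is already trivial. -/
theorem eq_zero_of_sum_eq_zero {ρ : ℂ} {w : D.Eig → ℂ → D.Row → ℂ}
    (hw : ∀ b, D.IsInfinitySolution η₀ ρ b (w b))
    (hΓ : ∀ b : D.Eig, Complex.Gamma (-ρ - D.mu b.1) ≠ 0) {c : D.Eig → ℂ}
    (h0 : ∀ ζ ∈ D.cutPlane η₀, ∑ b, c b • w b ζ = 0) : c = 0 := by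
  choose h hd hh0 hh using fun b => (hw b).exists_expansion (hΓ b)
  obtain ⟨Q, -, hQP⟩ := D.P_invertible
  set M : ℂ → Matrix D.Row D.Eig ℂ := fun x => Matrix.of fun a b => h b x a with hM
  have hcont : ContinuousAt (fun x => (Q * M x).det) 0 := by
    have : ContinuousAt M 0 := by
      refine continuousAt_pi.2 fun a => continuousAt_pi.2 fun b => ?_
      exact ((continuous_apply a).continuousAt).comp (hd b 0 (by simp)).continuousAt
    exact (continuous_id.matrix_det.continuousAt).comp
      ((continuous_const.matrix_mul continuous_id).continuousAt.comp this)
  have hM0 : M 0 = D.P := by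
    ext a b
    simp [hM, hh0]
  have hdet0 : (Q * M 0).det ≠ 0 := by rw [hM0, hQP]; simp
  obtain ⟨ε, hε, hball⟩ := Metric.eventually_nhds_iff.1 (hcont.eventually_ne hdet0)
  -- The extra index `none`, with weight ε⁻¹, encodes r < ε among the inequalities placing the point
  -- in the core.
  obtain ⟨r, hr0, hr⟩ := exists_lt_norm_of_forall_mul_lt (c := fun i : Option (Fin D.p) =>
    i.elim ε⁻¹ D.rad) (r := 0) (by simp)
  obtain ⟨s, hs, hsr⟩ := exists_mem_logCore hr0 (fun i => hr (some i))
  have hxε : ‖Complex.exp (-s)‖ < ε := by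
    rw [hsr]
    have := hr none
    simp only [Option.elim_none] at this
    rwa [inv_mul_lt_iff₀ hε, mul_one] at this
  have hdet : (Q * M (Complex.exp (-s))).det ≠ 0 := hball (by simpa using hxε)
  have h1 := h0 _ (add_exp_mem_cutPlane (D.isRightwardDomain.core_subset hs))
  have h2 : M (Complex.exp (-s)) *ᵥ (fun b => c b * Complex.exp ((ρ + D.mu b.1) * s)) = 0 := by
    rw [← h1]
    ext a
    simp only [Matrix.mulVec, dotProduct, hM, Matrix.of_apply, Finset.sum_apply]
    refine Finset.sum_congr rfl fun b _ => ?_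
    rw [hh b s hs]
    simp only [Pi.smul_apply, smul_eq_mul]
    ring
  have h3 := Matrix.eq_zero_of_mulVec_eq_zero hdet
    (v := fun b => c b * Complex.exp ((ρ + D.mu b.1) * s))
    (by rw [← Matrix.mulVec_mulVec, h2, Matrix.mulVec_zero])
  ext b
  have h4 := congrFun h3 b
  simpa [Complex.exp_ne_zero] using h4

theorem card_row_eq_card_eig : Fintype.card D.Row = Fintype.card D.Eig := by
  obtain ⟨Q, hPQ, hQP⟩ := D.P_invertible
  exact Matrix.square_of_invertible D.P Q hPQ hQP

/-- A combination vanishing at ζ₁ vanishes identically, so evaluation at ζ₁ is injective, hence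
bijective by equality of dimensions. -/
theorem exists_sum_eq {ρ : ℂ} {w : D.Eig → ℂ → D.Row → ℂ}
    (hw : ∀ b, D.IsInfinitySolution η₀ ρ b (w b))
    (hΓ : ∀ b : D.Eig, Complex.Gamma (-ρ - D.mu b.1) ≠ 0) {ζ₁ : ℂ} (hζ₁ : ζ₁ ∈ D.cutPlane η₀)
    (v : D.Row → ℂ) : ∃ c : D.Eig → ℂ, ∑ b, c b • w b ζ₁ = v := by
  let f : (D.Eig → ℂ) →ₗ[ℂ] (D.Row → ℂ) := Fintype.linearCombination ℂ (fun b => w b ζ₁)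
  have hinj : Function.Injective f := by
    rw [injective_iff_map_eq_zero]
    intro c hc
    refine eq_zero_of_sum_eq_zero hw hΓ ?_
    exact (IsSolutionOn.sum (fun b => (hw b).1) c).eq_zero hζ₁ hc
  have hsurj := (LinearMap.injective_iff_surjective_of_finrank_eq_finrank (f := f)
    (by simp only [Module.finrank_fintype_fun_eq_card]; exact card_row_eq_card_eig.symm)).1 hinj
  exact hsurj v

/-! ### Solutions at the finite singular points -/

/-- The exponent of `A` belonging to the row index `a`. -/
def rowLam (D : OkuboData) (a : D.Row) : ℂ := D.lam a.1 a.2.1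

theorem A_mulVec_of_support {i : Fin D.p} {z : D.Row → ℂ} (hz : ∀ b : D.Row, b.1 ≠ i → z b = 0)
    {b : D.Row} (hb : b.1 = i) : (D.A *ᵥ z) b = D.rowLam b * z b := by
  subst hb
  rw [Matrix.mulVec, dotProduct, Finset.sum_eq_single b]
  · obtain ⟨i, x⟩ := b
    rw [D.diag_block, Matrix.diagonal_apply_eq]
    rfl
  · intro c _ hcb
    by_cases hc : c.1 = b.1
    · obtain ⟨i, x⟩ := b
      obtain ⟨j, y⟩ := c
      obtain rfl : j = i := hc
      rw [D.diag_block, Matrix.diagonal_apply_ne, zero_mul]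
      rintro rfl
      exact hcb rfl
    · rw [hz c hc, mul_zero]
  · simp

theorem rowLam_sub_add_ne_zero {a b : D.Row} (h : b.1 = a.1) (m : ℕ) :
    D.rowLam a - D.rowLam b + (m + 1) ≠ 0 := by
  obtain ⟨i, k, x⟩ := a
  obtain ⟨j, k', y⟩ := b
  obtain rfl : j = i := h
  simp only [rowLam]
  by_cases hk : k = k'
  · subst hk
    rw [sub_self, zero_add]
    exact_mod_cast Nat.succ_ne_zero m
  · intro h0
    refine D.lam_sub_lam _ _ _ hk (-(m + 1)) ?_
    push_cast
    linear_combination h0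

/-- The diagonal factor vanishes on the block of `a`, so the recurrence fixes the next coefficient
only outside this block. Inside it, the coefficient is chosen to meet the solvability condition of
the following step, the last conclusion; the diagonal form of A_{ii} turns this into division by λ_a
- λ_b + m + 1. -/
theorem exists_recurrence_origin (η₀ ρ : ℂ) (a : D.Row)
    (hα : ∀ m : ℕ, ρ + D.rowLam a + (m + 1) ≠ 0) :
    ∃ c : ℕ → D.Row → ℂ, c 0 = Pi.single a 1 ∧
      (∀ m : ℕ, (ρ + D.rowLam a + m) • c m -
        (ρ • (1 : Matrix D.Row D.Row ℂ) + D.A) *ᵥ c m = (ρ + D.rowLam a + (m + 1)) •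
          (Matrix.diagonal fun b : D.Row => D.t' η₀ b.1 - D.t' η₀ a.1) *ᵥ c (m + 1)) ∧
      ∀ (m : ℕ) (b : D.Row), b.1 = a.1 → (ρ + D.rowLam a + m) * c m b =
        ((ρ • (1 : Matrix D.Row D.Row ℂ) + D.A) *ᵥ c m) b := by
  set τ : D.Row → ℂ := fun b => D.t' η₀ b.1 - D.t' η₀ a.1 with hτ
  set α := ρ + D.rowLam a with hαdef
  have hτ0 : ∀ b : D.Row, b.1 ≠ a.1 → τ b ≠ 0 := by
    intro b hb h
    refine hb ?_
    have h1 : D.t' η₀ b.1 - η₀ = D.t' η₀ a.1 - η₀ := by linear_combination h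
    simp only [t', add_sub_cancel_left, one_div, inv_inj, sub_left_inj] at h1
    exact Fin.castSucc_injective _ (D.t_injective h1)
  have hstep : ∀ (m : ℕ) (r : D.Row → ℂ), ∃ v : D.Row → ℂ,
      (∀ b : D.Row, b.1 ≠ a.1 → r b = (α + (m + 1)) * (τ b * v b)) ∧
      ∀ b : D.Row, b.1 = a.1 → (α + (m + 1)) * v b =
        ((ρ • (1 : Matrix D.Row D.Row ℂ) + D.A) *ᵥ v) b := by
    intro m r
    -- `u` is the part outside the block, given by the recurrence; `z` is the part inside it, given
    -- by the solvability condition.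
    set u : D.Row → ℂ := fun b => if b.1 = a.1 then 0 else r b / (τ b * (α + (m + 1))) with hu
    set z : D.Row → ℂ := fun b => if b.1 = a.1 then
      (D.rowLam a - D.rowLam b + (m + 1))⁻¹ * (D.A *ᵥ u) b else 0 with hz
    refine ⟨u + z, fun b hb => ?_, fun b hb => ?_⟩
    · have h1 := hτ0 b hb
      have h2 := hα m
      simp only [hu, hz, Pi.add_apply, if_neg hb]
      field_simp
      ring
    · have h1 := rowLam_sub_add_ne_zero hb m
      have h2 := A_mulVec_of_support (i := a.1) (z := z) (fun b hb => by simp [hz, hb]) hb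
      have h3 : z b = (D.rowLam a - D.rowLam b + (m + 1))⁻¹ * (D.A *ᵥ u) b := by simp [hz, hb]
      have h4 : u b = 0 := by simp [hu, hb]
      have h5 : (D.A *ᵥ u) b = (D.rowLam a - D.rowLam b + (m + 1)) * z b := by
        rw [h3]; field_simp
      rw [Matrix.add_mulVec, Matrix.smul_mulVec, Matrix.one_mulVec, Matrix.mulVec_add]
      simp only [Pi.add_apply, Pi.smul_apply, smul_eq_mul, h2, h4, h5]
      rw [hαdef]
      ring
  choose f hf1 hf2 using hstep
  let c : ℕ → D.Row → ℂ := fun m => Nat.rec (Pi.single a 1) (fun m v => f m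
    ((α + m) • v - (ρ • (1 : Matrix D.Row D.Row ℂ) + D.A) *ᵥ v)) m
  have hc2 : ∀ (m : ℕ) (b : D.Row), b.1 = a.1 → (α + m) * c m b =
      ((ρ • (1 : Matrix D.Row D.Row ℂ) + D.A) *ᵥ c m) b := by
    intro m b hb
    rcases m with _ | m
    · show (α + (0 : ℕ)) * (Pi.single a 1 : D.Row → ℂ) b =
        ((ρ • (1 : Matrix D.Row D.Row ℂ) + D.A) *ᵥ (Pi.single a 1 : D.Row → ℂ)) b
      have h2 := A_mulVec_of_support (i := a.1) (z := (Pi.single a 1 : D.Row → ℂ))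
        (fun b hb => by
          rw [Pi.single_apply, if_neg]
          rintro rfl
          exact hb rfl) hb
      rw [Matrix.add_mulVec, Matrix.smul_mulVec, Matrix.one_mulVec, Pi.add_apply, h2]
      by_cases hba : b = a
      · subst hba; simp [hαdef]
      · simp [hba]
    · have := hf2 m ((α + m) • c m - (ρ • (1 : Matrix D.Row D.Row ℂ) + D.A) *ᵥ c m) b hb
      push_cast
      exact this
  refine ⟨c, rfl, fun m => ?_, hc2⟩
  ext b
  rw [Pi.smul_apply, Matrix.mulVec_diagonal, smul_eq_mul]
  by_cases hb : b.1 = a.1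
  · have h1 : τ b = 0 := by simp only [hτ, hb, sub_self]
    rw [h1, zero_mul, mul_zero, Pi.sub_apply, Pi.smul_apply, smul_eq_mul, hc2 m b hb, sub_self]
  · exact hf1 m _ b hb

theorem summable_of_recurrence_origin {ρ α : ℂ} {a : D.Row} {c : ℕ → D.Row → ℂ}
    (hc1 : ∀ m : ℕ, (α + m) • c m -
        (ρ • (1 : Matrix D.Row D.Row ℂ) + D.A) *ᵥ c m = (α + (m + 1)) •
          (Matrix.diagonal fun b : D.Row => D.t' η₀ b.1 - D.t' η₀ a.1) *ᵥ c (m + 1))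
    (hc2 : ∀ (m : ℕ) (b : D.Row), b.1 = a.1 → (α + m) * c m b =
        ((ρ • (1 : Matrix D.Row D.Row ℂ) + D.A) *ᵥ c m) b) {x : ℂ}
    (hx : ∀ j, j ≠ a.1 → ‖x‖ < ‖D.t' η₀ j - D.t' η₀ a.1‖) : Summable fun m => x ^ m • c m := by
  have hpos : ∀ j, j ≠ a.1 → 0 < ‖D.t' η₀ j - D.t' η₀ a.1‖ := fun j hj =>
    (norm_nonneg x).trans_lt (hx j hj)
  obtain ⟨R, hR0, hR, hRx⟩ := exists_bound_lt
    (c := fun j : {j : Fin D.p // j ≠ a.1} => ‖D.t' η₀ j - D.t' η₀ a.1‖⁻¹) (r := ‖x‖)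
    (fun j => by positivity) (fun j => by
      rw [inv_mul_lt_iff₀ (hpos j j.2), mul_one]; exact hx j j.2)
  set L := matL (ρ • (1 : Matrix D.Row D.Row ℂ) + D.A) with hL
  refine summable_pow_smul_of_ratio_le (C := ‖α‖ + ‖L‖) hR0 (by positivity) hRx fun m => ?_
  have : Nonempty D.Row := ⟨a⟩
  -- A component realizing the sup norm. Outside the block of `a` the recurrence bounds it by c m;
  -- inside, the solvability condition gives (m - C)‖c (m + 1)‖ ≤ 0.
  obtain ⟨b, hb⟩ := Finite.exists_max fun b => ‖c (m + 1) b‖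
  have hnorm : ‖c (m + 1)‖ = ‖c (m + 1) b‖ :=
    le_antisymm ((pi_norm_le_iff_of_nonneg (norm_nonneg _)).2 hb) (norm_le_pi_norm _ b)
  have hlow : (m : ℝ) + 1 - ‖α‖ ≤ ‖α + (m + 1)‖ := by
    have h3 : ‖(m : ℂ) + 1‖ = m + 1 := by
      rw [← Nat.cast_succ, Complex.norm_natCast, Nat.cast_succ]
    have := norm_sub_le (α + ((m : ℂ) + 1)) α
    rw [add_sub_cancel_left, h3] at this
    linarith
  have hlow' : ((m : ℝ) + 1 - ‖α‖) * ‖c (m + 1)‖ ≤ ‖α + (m + 1)‖ * ‖c (m + 1) b‖ := by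
    rw [hnorm]; exact mul_le_mul_of_nonneg_right hlow (norm_nonneg _)
  have hn0 : 0 ≤ ‖c (m + 1)‖ := norm_nonneg _
  have hLc : 0 ≤ ‖L‖ * ‖c (m + 1)‖ := by positivity
  by_cases hba : b.1 = a.1
  · have h1 := congrArg norm (hc2 (m + 1) b hba)
    rw [norm_mul] at h1
    have h2 : ‖((ρ • (1 : Matrix D.Row D.Row ℂ) + D.A) *ᵥ c (m + 1)) b‖ ≤ ‖L‖ * ‖c (m + 1)‖ :=
      (norm_le_pi_norm (L (c (m + 1))) b).trans (L.le_opNorm _)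
    push_cast at h1
    have h3 : 0 ≤ ((m : ℝ) + (‖α‖ + ‖L‖)) * R * ‖c m‖ := by positivity
    linarith
  · have h1 := congrArg norm (congrFun (hc1 m) b)
    rw [Pi.smul_apply, Matrix.mulVec_diagonal, smul_eq_mul, norm_mul, norm_mul] at h1
    have h2 : ‖((α + m) • c m - (ρ • (1 : Matrix D.Row D.Row ℂ) + D.A) *ᵥ c m) b‖ ≤
        (‖α‖ + m + ‖L‖) * ‖c m‖ := by
      refine (norm_le_pi_norm _ b).trans ((norm_sub_le _ (L (c m))).trans ?_)
      rw [norm_smul, add_mul (‖α‖ + m)]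
      refine add_le_add (mul_le_mul_of_nonneg_right ((norm_add_le _ _).trans ?_)
        (norm_nonneg _)) (L.le_opNorm _)
      simp
    have h4 := hR ⟨b.1, hba⟩
    simp only at h4
    rw [inv_le_iff_one_le_mul₀ (hpos _ hba)] at h4
    have h5 : ‖α + (m + 1)‖ * ‖c (m + 1) b‖ ≤ R * ((‖α‖ + m + ‖L‖) * ‖c m‖) := by
      calc ‖α + (m + 1)‖ * ‖c (m + 1) b‖ = ‖α + (m + 1)‖ * ‖c (m + 1) b‖ * 1 := by ring
        _ ≤ ‖α + (m + 1)‖ * ‖c (m + 1) b‖ * (R * ‖D.t' η₀ b.1 - D.t' η₀ a.1‖) := by gcongr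
        _ = R * (‖α + (m + 1)‖ * (‖D.t' η₀ b.1 - D.t' η₀ a.1‖ * ‖c (m + 1) b‖)) := by ring
        _ ≤ _ := by rw [← h1]; gcongr
    linarith

/-! ### The cut plane near t'_i -/

/-- The disc of radius `δ` around `t'_i` cut along the radius in the direction of `η₀`. -/
def slitDisc (D : OkuboData) (η₀ : ℂ) (i : Fin D.p) (δ : ℝ) : Set ℂ :=
  {ζ | ‖ζ - D.t' η₀ i‖ < δ ∧
    (ζ - D.t' η₀ i) * Complex.exp (-(D.θ' i * Complex.I)) ∈ Complex.slitPlane}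

open scoped ComplexOrder in
theorem starConvex_slitDisc (i : Fin D.p) {δ : ℝ} (hδ : 0 < δ) :
    StarConvex ℝ (D.t' η₀ i + (δ / 2 : ℝ) * Complex.exp (D.θ' i * Complex.I))
      (D.slitDisc η₀ i δ) := by
  have hn : ‖((δ / 2 : ℝ) : ℂ) * Complex.exp (D.θ' i * Complex.I)‖ = δ / 2 := by
    rw [norm_mul, Complex.norm_exp_ofReal_mul_I, mul_one, Complex.norm_real,
      Real.norm_of_nonneg (by positivity)]
  rintro ζ ⟨h1, h2⟩ p q hp hq hpq
  have hsub : p • (D.t' η₀ i + (δ / 2 : ℝ) * Complex.exp (D.θ' i * Complex.I)) + q • ζ -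
      D.t' η₀ i =
        p • (((δ / 2 : ℝ) : ℂ) * Complex.exp (D.θ' i * Complex.I)) + q • (ζ - D.t' η₀ i) := by
    have : (p : ℂ) + q = 1 := by exact_mod_cast hpq
    simp only [Complex.real_smul]
    linear_combination (D.t' η₀ i) * this
  constructor
  · rw [hsub]
    have h3 := convex_ball (0 : ℂ) δ (x := ((δ / 2 : ℝ) : ℂ) * Complex.exp (D.θ' i * Complex.I))
      (by rw [mem_ball_zero_iff, hn]; linarith) (mem_ball_zero_iff.2 h1) hp hq hpq
    simpa using h3
  · rw [hsub]
    have hpos : (0 : ℂ) < ((δ / 2 : ℝ) : ℂ) := by exact_mod_cast half_pos hδ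
    have h3 := Complex.starConvex_slitPlane hpos h2 hp hq hpq
    convert! h3 using 1
    have hexp : Complex.exp (D.θ' i * Complex.I) * Complex.exp (-(D.θ' i * Complex.I)) = 1 := by
      rw [← Complex.exp_add]; simp
    simp only [Complex.real_smul]
    linear_combination (p : ℂ) * ((δ / 2 : ℝ) : ℂ) * hexp

theorem center_mem_slitDisc (i : Fin D.p) {δ : ℝ} (hδ : 0 < δ) :
    D.t' η₀ i + (δ / 2 : ℝ) * Complex.exp (D.θ' i * Complex.I) ∈ D.slitDisc η₀ i δ := by
  constructor
  · rw [add_sub_cancel_left, norm_mul, Complex.norm_exp_ofReal_mul_I, mul_one, Complex.norm_real,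
      Real.norm_of_nonneg (by positivity)]
    linarith
  · rw [add_sub_cancel_left, mul_assoc, ← Complex.exp_add, add_neg_cancel, Complex.exp_zero,
      mul_one, Complex.ofReal_mem_slitPlane]
    exact half_pos hδ

theorem t'_eq_add_exp (i : Fin D.p) :
    D.t' η₀ i = η₀ + Complex.exp (Real.log (D.rad i) + D.θ' i * Complex.I) := by
  rw [← sub_eq_iff_eq_add', D.t'_sub, Complex.exp_add, ← Complex.ofReal_exp,
    Real.exp_log (D.rad_pos i)]

/-- All θ' lie in one open interval of length 2π, so distinct angles give distinct directions from
η₀. -/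
theorem t'_ne_segment {i j : Fin D.p} (hij : j ≠ i) {σ : ℝ} (hσ : 0 ≤ σ) :
    D.t' η₀ i ≠ η₀ + (D.t' η₀ j - η₀) * σ := by
  intro h
  rcases hσ.eq_or_lt with rfl | hσ
  · have := D.norm_t'_sub η₀ i
    rw [h] at this
    simp at this
    exact (D.rad_pos i).ne this
  · have h1 : η₀ + (D.t' η₀ j - η₀) * σ =
        η₀ + Complex.exp (Real.log (D.rad j * σ) + D.θ' j * Complex.I) := by
      rw [D.t'_sub, Complex.exp_add, ← Complex.ofReal_exp,
        Real.exp_log (mul_pos (D.rad_pos j) hσ)]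
      push_cast
      ring
    rw [h1, t'_eq_add_exp] at h
    have h2 := congrArg (D.logCut η₀) h
    rw [logCut_add_exp (by simpa using D.θ'inf_lt i) (by simpa using D.θ'_lt i),
      logCut_add_exp (by simpa using D.θ'inf_lt j) (by simpa using D.θ'_lt j)] at h2
    have h3 := congrArg Complex.im h2
    simp at h3
    exact hij (D.θ'_injective h3.symm)

/-- Near `t'_i` the cut plane is a slit disc. -/
theorem exists_slitDisc (η₀ : ℂ) (i : Fin D.p) : ∃ δ > 0,
    (∀ j, j ≠ i → δ ≤ ‖D.t' η₀ j - D.t' η₀ i‖) ∧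
    ∀ ζ, ‖ζ - D.t' η₀ i‖ < δ → (ζ ∈ D.cutPlane η₀ ↔ ζ ∈ D.slitDisc η₀ i δ) := by
  have hseg : ∀ j, j ≠ i → ∀ᶠ ζ in 𝓝 (D.t' η₀ i), ∀ σ : ℝ, 0 ≤ σ → σ ≤ 1 →
      ζ ≠ η₀ + (D.t' η₀ j - η₀) * σ := by
    intro j hj
    have hcl : IsClosed ((fun σ : ℝ => η₀ + (D.t' η₀ j - η₀) * σ) '' Set.Icc 0 1) :=
      (isCompact_Icc.image (by fun_prop)).isClosed
    filter_upwards [hcl.isOpen_compl.mem_nhds (by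
      rintro ⟨σ, hσ, h⟩
      exact t'_ne_segment hj hσ.1 h.symm)] with ζ hζ σ h0 h1 h
    exact hζ ⟨σ, ⟨h0, h1⟩, h.symm⟩
  have hray : ∀ᶠ ζ in 𝓝 (D.t' η₀ i), ∀ s : ℝ, 0 ≤ s →
      ζ ≠ η₀ + s * Complex.exp (D.θ'inf * Complex.I) := by
    simp only [D.not_mem_ray_iff η₀]
    refine ContinuousAt.preimage_mem_nhds (by fun_prop)
      (Complex.isOpen_slitPlane.mem_nhds ?_)
    rw [t'_eq_add_exp, add_sub_cancel_left]
    exact exp_mul_mem_slitPlane (by simpa using D.θ'inf_lt i) (by simpa using D.θ'_lt i)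
  obtain ⟨δ, hδ, hball⟩ := Metric.eventually_nhds_iff.1
    ((Filter.eventually_all.2 fun j => Filter.eventually_imp_distrib_left.2 (hseg j)).and hray)
  -- The bound by `rad i` keeps the slit of the disc inside the segment, before it would pass beyond
  -- η₀.
  refine ⟨min δ (D.rad i), lt_min hδ (D.rad_pos i), fun j hj => ?_, fun ζ hζ => ?_⟩
  · refine (min_le_left _ _).trans (le_of_not_gt fun hlt => ?_)
    exact (hball (by rwa [dist_eq_norm])).1 j hj 1 zero_le_one le_rfl (by simp)
  · obtain ⟨h1, h2⟩ := hball (y := ζ) (by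
      rw [dist_eq_norm]; exact hζ.trans_le (min_le_left _ _))
    have hζr := hζ.trans_le (min_le_right _ _)
    have hr : (D.rad i : ℂ) ≠ 0 := by exact_mod_cast (D.rad_pos i).ne'
    constructor
    · intro hcut
      refine ⟨hζ, (mul_exp_neg_mem_slitPlane_iff _ _).2 fun s hs heq => ?_⟩
      have hs' : s < D.rad i := by
        rw [heq, norm_neg, norm_mul, Complex.norm_exp_ofReal_mul_I, mul_one, Complex.norm_real,
          Real.norm_of_nonneg hs] at hζr
        exact hζr
      refine hcut.1 i (1 - s / D.rad i) ?_ ?_ ?_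
      · rw [sub_nonneg, div_le_one (D.rad_pos i)]; exact hs'.le
      · have := div_nonneg hs (D.rad_pos i).le
        linarith
      · have h3 := D.t'_sub η₀ i
        have h4 : ζ = D.t' η₀ i - s * Complex.exp (D.θ' i * Complex.I) := by
          linear_combination heq
        rw [h4]
        push_cast
        rw [h3]
        field_simp
        linear_combination h3
    · rintro ⟨-, hslit⟩
      refine ⟨fun j σ h0 hσ1 => ?_, h2⟩
      by_cases hj : j = i
      · subst hj
        intro heq
        refine (mul_exp_neg_mem_slitPlane_iff _ _).1 hslit ((1 - σ) * D.rad j)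
          (mul_nonneg (by linarith) (D.rad_pos j).le) ?_
        have h3 := D.t'_sub η₀ j
        rw [heq]
        push_cast
        linear_combination -(1 - (σ : ℂ)) * h3
      · exact h1 j hj σ h0 hσ1

end OkuboData

namespace OkuboData

variable {D : OkuboData} {η₀ : ℂ}

/-! ### Frobenius solutions and their continuation -/

theorem Gamma_add_nat_ne_zero {s : ℂ} (hs : NotInt s) (m : ℕ) :
    Complex.Gamma (s + 1 + m) ≠ 0 := by
  refine Complex.Gamma_ne_zero fun n h => hs (-(n + m + 1)) ?_
  push_cast
  linear_combination h

/-- The Frobenius series at `t'_i` solves the system on a slit disc. -/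
theorem hasDerivAt_frobenius {ρ : ℂ} {a : D.Row} {c : ℕ → D.Row → ℂ} (hc0 : c 0 = Pi.single a 1)
    (hc1 : ∀ m : ℕ, (ρ + D.rowLam a + m) • c m -
        (ρ • (1 : Matrix D.Row D.Row ℂ) + D.A) *ᵥ c m = (ρ + D.rowLam a + (m + 1)) •
          (Matrix.diagonal fun b : D.Row => D.t' η₀ b.1 - D.t' η₀ a.1) *ᵥ c (m + 1))
    {ζ y : ℂ} (hy : Summable fun m => y ^ m • c m) (hζy : ‖ζ - D.t' η₀ a.1‖ < ‖y‖)
    (hne : ∀ i, ζ ≠ D.t' η₀ i)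
    (hslit : (ζ - D.t' η₀ a.1) * Complex.exp (-(D.θ' a.1 * Complex.I)) ∈ Complex.slitPlane) :
    HasDerivAt (fun ζ => Complex.exp ((ρ + D.rowLam a) * logBranch (D.θ' a.1) (ζ - D.t' η₀ a.1)) •
        ∑' m : ℕ, (ζ - D.t' η₀ a.1) ^ m • c m)
      (D.coeffField η₀ ρ ζ
        (Complex.exp ((ρ + D.rowLam a) * logBranch (D.θ' a.1) (ζ - D.t' η₀ a.1)) •
          ∑' m : ℕ, (ζ - D.t' η₀ a.1) ^ m • c m)) ζ := by
  set α := ρ + D.rowLam a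
  set x := ζ - D.t' η₀ a.1 with hx
  set S := Matrix.diagonal fun b : D.Row => D.t' η₀ b.1 - D.t' η₀ a.1 with hS
  have hS0 : matL S (c 0) = 0 := by
    rw [hc0, matL_apply]
    ext b
    rw [hS, Matrix.mulVec_diagonal]
    by_cases hb : b = a
    · subst hb; simp
    · simp [hb]
  obtain ⟨h', hd, heq⟩ := hasDerivAt_of_recurrence_origin (S := matL S)
    (A := matL (ρ • (1 : Matrix D.Row D.Row ℂ) + D.A)) (α := α) (x := x) hS0
    (fun m => by simpa using hc1 m) hy hζy
  have hx0 : x ≠ 0 := sub_ne_zero.2 (hne a.1)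
  have e1 : HasDerivAt (fun ζ => ζ - D.t' η₀ a.1) 1 ζ := (hasDerivAt_id ζ).sub_const _
  have e2 : HasDerivAt (fun ζ => logBranch (D.θ' a.1) (ζ - D.t' η₀ a.1)) x⁻¹ ζ :=
    (hasDerivAt_logBranch (D.θ' a.1) hslit).comp_sub_const ζ _
  have e3 : HasDerivAt (fun ζ => ∑' m : ℕ, (ζ - D.t' η₀ a.1) ^ m • c m) h' ζ :=
    hd.comp_sub_const ζ _
  convert! (e2.const_mul α).cexp.smul e3 using 1
  set H := ∑' m : ℕ, x ^ m • c m with hH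
  ext b
  have hxb : ζ - D.t' η₀ b.1 ≠ 0 := sub_ne_zero.2 (hne b.1)
  have heqb := congrFun heq b
  rw [coeffField_apply, Matrix.mulVec_smul]
  simp only [matL_apply, S, Pi.sub_apply, Pi.add_apply, Pi.smul_apply, smul_eq_mul,
    Matrix.mulVec_diagonal] at heqb
  simp only [Pi.add_apply, Pi.smul_apply, smul_eq_mul]
  rw [← hx]
  have hxx : ζ = x + D.t' η₀ a.1 := by rw [hx]; ring
  field_simp
  rw [hxx]
  linear_combination -heqb

/-- The combination of solutions at infinity that equals the Frobenius series at one point of the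
slit disc equals it on the whole star-shaped disc. It is the continuation, and its coefficients are
the connection coefficients. -/
theorem exists_isFiniteSolution {ρ : ℂ} {winf : D.Eig → ℂ → D.Row → ℂ}
    (hw : ∀ b, D.IsInfinitySolution η₀ ρ b (winf b))
    (hΓ : ∀ b : D.Eig, Complex.Gamma (-ρ - D.mu b.1) ≠ 0) (a : D.Row)
    (hα : NotInt (ρ + D.rowLam a)) :
    ∃ C : D.Eig → ℂ, D.IsFiniteSolution η₀ ρ a (fun ζ => ∑ b, C b • winf b ζ) := by
  obtain ⟨c, hc0, hc1, hc2⟩ := exists_recurrence_origin η₀ ρ a (fun m h => by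
    refine hα (-(m + 1)) ?_
    push_cast
    linear_combination h)
  set α := ρ + D.rowLam a with hαdef
  have hsum : ∀ x : ℂ, (∀ j, j ≠ a.1 → ‖x‖ < ‖D.t' η₀ j - D.t' η₀ a.1‖) →
      Summable fun m => x ^ m • c m := fun x hx => summable_of_recurrence_origin hc1 hc2 hx
  obtain ⟨δ, hδ, hδt, hδcut⟩ := exists_slitDisc η₀ a.1
  set W : ℂ → D.Row → ℂ := fun ζ =>
    Complex.exp (α * logBranch (D.θ' a.1) (ζ - D.t' η₀ a.1)) •
        ∑' m : ℕ, (ζ - D.t' η₀ a.1) ^ m • c m with hWdef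
  -- Halving lets the radius itself serve as a point of convergence.
  have hδ2 : 0 < δ / 2 := half_pos hδ
  have hsub : D.slitDisc η₀ a.1 (δ / 2) ⊆ D.cutPlane η₀ := fun ζ hζ =>
    (hδcut ζ (by linarith [hζ.1])).2 ⟨by linarith [hζ.1], hζ.2⟩
  have hW : ∀ ζ ∈ D.slitDisc η₀ a.1 (δ / 2), HasDerivAt W (D.coeffField η₀ ρ ζ (W ζ)) ζ := by
    intro ζ hζ
    have hn : ‖((δ / 2 : ℝ) : ℂ)‖ = δ / 2 := by
      rw [Complex.norm_real, Real.norm_of_nonneg hδ2.le]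
    exact hasDerivAt_frobenius hc0 hc1 (y := (δ / 2 : ℝ))
      (hsum _ fun j hj => by rw [hn]; linarith [hδt j hj]) (by rw [hn]; exact hζ.1)
      (fun i => D.ne_t'_of_mem η₀ (hsub hζ) i) hζ.2
  have hζ₁ := center_mem_slitDisc (D := D) (η₀ := η₀) a.1 hδ2
  set ζ₁ := D.t' η₀ a.1 + (δ / 2 / 2 : ℝ) * Complex.exp (D.θ' a.1 * Complex.I)
  obtain ⟨C, hC⟩ := exists_sum_eq hw hΓ (hsub hζ₁) (W ζ₁)
  have hsol := IsSolutionOn.sum (fun b => (hw b).1) C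
  have hsol' := (isSolutionOn_iff fun _ h => D.ne_t'_of_mem η₀ h).1 hsol
  have heq : ∀ ζ ∈ D.slitDisc η₀ a.1 (δ / 2), ∑ b, C b • winf b ζ = W ζ := by
    intro ζ hζ
    refine sub_eq_zero.1 (eq_zero_of_starConvex (w := fun ζ => ∑ b, C b • winf b ζ - W ζ)
      (starConvex_slitDisc a.1 hδ2) (B := D.coeffField η₀ ρ)
      ((D.differentiableOn_coeffField η₀ ρ fun ζ hζ =>
        D.ne_t'_of_mem η₀ (hsub hζ)).continuousOn) (fun y hy => ?_)
      (sub_eq_zero.2 hC) ζ hζ)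
    rw [map_sub]
    exact (hsol' y (hsub hy)).sub (hW y hy)
  have hΓa : Complex.Gamma (α + 1) ≠ 0 := by simpa using Gamma_add_nat_ne_zero hα 0
  have hterm : ∀ (x : ℂ) (m : ℕ),
      (Complex.Gamma (α + 1) / Complex.Gamma (α + 1 + m) * x ^ m) •
        ((Complex.Gamma (α + 1 + m) / Complex.Gamma (α + 1)) • c m) = x ^ m • c m := by
    intro x m
    have := Gamma_add_nat_ne_zero hα m
    rw [smul_smul]
    congr 1
    field_simp
  refine ⟨C, hsol,
    fun m => (Complex.Gamma (α + 1 + m) / Complex.Gamma (α + 1)) • c m, ?_, ?_, ?_⟩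
  · simp only [Nat.cast_zero, add_zero, div_self hΓa, one_smul, hc0]
  · intro ζ hζ
    refine (hsum _ hζ).congr fun m => ?_
    exact (hterm _ m).symm
  · rw [Filter.eventually_iff_exists_mem]
    refine ⟨Metric.ball (D.t' η₀ a.1) (δ / 2) ∩ D.cutPlane η₀,
      Filter.inter_mem (mem_nhdsWithin_of_mem_nhds (Metric.ball_mem_nhds _ hδ2))
        self_mem_nhdsWithin, fun ζ hζ => ?_⟩
    have h1 : ‖ζ - D.t' η₀ a.1‖ < δ / 2 := by
      have := hζ.1
      rwa [Metric.mem_ball, dist_eq_norm] at this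
    have h2 := (hδcut ζ (by linarith)).1 hζ.2
    show ∑ b, C b • winf b ζ = _
    rw [heq ζ ⟨h1, h2.2⟩, hWdef]
    refine congrArg₂ _ rfl (tsum_congr fun m => ?_)
    exact (hterm _ m).symm

/-! ### The first integrals of the system at `ρ = -μ_l - 1` -/

/-- A nonintegral power on a slit disc is not a function continuous across the slit. -/
theorem eq_zero_of_nonintegral_power {α C : ℂ} (hα : NotInt α) {φ τ : ℝ} (hτ : 0 < τ)
    {H : ℂ → ℂ} (hH : ContinuousAt H (-(τ * Complex.exp (φ * Complex.I))))
    (h : ∀ᶠ x in 𝓝 (-((τ : ℂ) * Complex.exp (φ * Complex.I))),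
      x * Complex.exp (-(φ * Complex.I)) ∈ Complex.slitPlane →
        Complex.exp (α * logBranch φ x) * H x = C) : C = 0 := by
  set e := Complex.exp (φ * Complex.I) with he
  have hee : e * Complex.exp (-(φ * Complex.I)) = 1 := by rw [he, ← Complex.exp_add]; simp
  set z₀ : ℂ := ((-τ : ℝ) : ℂ) with hz₀
  have hz₀re : z₀.re < 0 := by simp [hz₀, hτ]
  have hz₀im : z₀.im = 0 := by simp [hz₀]
  have hz₀e : z₀ * e = -((τ : ℂ) * e) := by simp [hz₀]
  have hmul : Filter.Tendsto (fun z : ℂ => z * e) (𝓝 z₀) (𝓝 (-((τ : ℂ) * e))) := by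
    rw [← hz₀e]
    exact (continuous_mul_const e).continuousAt
  have hev := hmul.eventually h
  have hHt := hH.tendsto.comp hmul
  have hbranch : ∀ z : ℂ, logBranch φ (z * e) = Complex.log z + φ * Complex.I := fun z => by
    rw [logBranch, mul_assoc, hee, mul_one]
  have key : ∀ (S : Set ℂ) (L : ℂ), S ⊆ {z | z.im ≠ 0} → (𝓝[S] z₀).NeBot →
      Filter.Tendsto Complex.log (𝓝[S] z₀) (𝓝 L) →
      Complex.exp (α * (L + φ * Complex.I)) * H (-((τ : ℂ) * e)) = C := by
    intro S L hS hne hL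
    have h1 : Filter.Tendsto (fun z => Complex.exp (α * logBranch φ (z * e)) * H (z * e))
        (𝓝[S] z₀) (𝓝 (Complex.exp (α * (L + φ * Complex.I)) * H (-((τ : ℂ) * e)))) := by
      simp only [hbranch]
      refine Filter.Tendsto.mul ?_ (hHt.mono_left nhdsWithin_le_nhds)
      exact (Complex.continuous_exp.tendsto _).comp ((hL.add_const _).const_mul α)
    refine tendsto_nhds_unique_of_eventuallyEq h1 (tendsto_const_nhds (x := C)) ?_
    filter_upwards [self_mem_nhdsWithin, hev.filter_mono nhdsWithin_le_nhds] with z hz hz'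
    refine hz' ?_
    rw [mul_assoc, hee, mul_one]
    exact Complex.mem_slitPlane_iff.2 (Or.inr (hS hz))
  have hnb : ∀ (u : ℝ) (S : Set ℂ), (∀ s : ℝ, 0 < s → z₀ + s * (u * Complex.I) ∈ S) →
      (𝓝[S] z₀).NeBot := by
    intro u S hS
    rw [← mem_closure_iff_nhdsWithin_neBot]
    have h1 : Filter.Tendsto (fun s : ℝ => z₀ + s * (u * Complex.I)) (𝓝[>] 0) (𝓝 z₀) := by
      refine Filter.Tendsto.mono_left ?_ nhdsWithin_le_nhds
      have : Continuous fun s : ℝ => z₀ + s * (u * Complex.I) := by fun_prop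
      simpa using this.tendsto 0
    refine mem_closure_of_tendsto h1 ?_
    filter_upwards [self_mem_nhdsWithin] with s hs using hS s hs
  have hup := key {z | 0 < z.im} _ (fun z hz => ne_of_gt hz)
    (hnb 1 _ fun s hs => by simpa [hz₀] using hs)
    ((Complex.tendsto_log_nhdsWithin_im_nonneg_of_re_neg_of_im_zero hz₀re hz₀im).mono_left
      (nhdsWithin_mono _ fun z (hz : 0 < z.im) => hz.le))
  have hdown := key {z | z.im < 0} _ (fun z hz => ne_of_lt hz)
    (hnb (-1) _ fun s hs => by simpa [hz₀] using hs)
    (Complex.tendsto_log_nhdsWithin_im_neg_of_re_neg_of_im_zero hz₀re hz₀im)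
  -- The one-sided limits of log differ by 2πi, so equality of both products with C forces exp(2πiα)
  -- = 1 unless the value of H is 0.
  by_contra hC
  have hH0 : H (-((τ : ℂ) * e)) ≠ 0 := by
    intro h0
    rw [h0, mul_zero] at hup
    exact hC hup.symm
  have h1 := mul_right_cancel₀ hH0 (hup.trans hdown.symm)
  obtain ⟨n, hn⟩ := Complex.exp_eq_exp_iff_exists_int.1 h1
  refine hα n ?_
  have h2 : (α - n) * (2 * Real.pi * Complex.I) = 0 := by linear_combination hn
  exact sub_eq_zero.1 ((mul_eq_zero.1 h2).resolve_right Complex.two_pi_I_ne_zero)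

/-- If `v` is a row eigenvector of `A` with eigenvalue `-ρ - 1`, then `v (ζ - T') w` is constant for
every solution `w`. -/
theorem hasDerivAt_firstIntegral {ρ : ℂ} {v : D.Row → ℂ} (hv : v ᵥ* D.A = (-ρ - 1) • v)
    {w : ℂ → D.Row → ℂ} (hw : D.IsSolutionOn η₀ ρ (D.cutPlane η₀) w) :
    ∀ ζ ∈ D.cutPlane η₀, HasDerivAt (fun ζ => ∑ a, v a * ((ζ - D.t' η₀ a.1) * w ζ a)) 0 ζ := by
  intro ζ hζ
  have hd := hasDerivAt_pi.1
    ((isSolutionOn_iff fun _ h => D.ne_t'_of_mem η₀ h).1 hw ζ hζ)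
  have h1 : HasDerivAt (fun ζ => ∑ a, v a * ((ζ - D.t' η₀ a.1) * w ζ a))
      (∑ a, v a * (1 * w ζ a + (ζ - D.t' η₀ a.1) * D.coeffField η₀ ρ ζ (w ζ) a)) ζ :=
    HasDerivAt.fun_sum fun a _ =>
      (((hasDerivAt_id ζ).sub_const (D.t' η₀ a.1)).mul (hd a)).const_mul (v a)
  convert h1 using 1
  have h2 : ∀ a : D.Row, v a * (1 * w ζ a + (ζ - D.t' η₀ a.1) * D.coeffField η₀ ρ ζ (w ζ) a) =
      (1 + ρ) * (v a * w ζ a) + v a * (D.A *ᵥ w ζ) a := by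
    intro a
    have hne := sub_ne_zero.2 (D.ne_t'_of_mem η₀ hζ a.1)
    rw [coeffField_apply, Matrix.add_mulVec, Matrix.smul_mulVec, Matrix.one_mulVec, Pi.add_apply,
      Pi.smul_apply, smul_eq_mul, mul_inv_cancel_left₀ hne]
    ring
  rw [Finset.sum_congr rfl fun a _ => h2 a, Finset.sum_add_distrib, ← Finset.mul_sum]
  have h3 : ∑ a, v a * (D.A *ᵥ w ζ) a = (-ρ - 1) * ∑ a, v a * w ζ a := by
    have : v ⬝ᵥ (D.A *ᵥ w ζ) = ((-ρ - 1) • v) ⬝ᵥ w ζ := by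
      rw [Matrix.dotProduct_mulVec, hv]
    rw [smul_dotProduct] at this
    exact this
  rw [h3]
  ring

/-- The first integral vanishes on the solutions at `t'_i`. -/
theorem IsFiniteSolution.firstIntegral_eq_zero {ρ : ℂ} {v : D.Row → ℂ}
    (hv : v ᵥ* D.A = (-ρ - 1) • v) {a : D.Row} (hα : NotInt (ρ + D.rowLam a))
    {w : ℂ → D.Row → ℂ} (hw : D.IsFiniteSolution η₀ ρ a w) {ζ : ℂ} (hζ : ζ ∈ D.cutPlane η₀) :
    ∑ b, v b * ((ζ - D.t' η₀ b.1) * w ζ b) = 0 := by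
  obtain ⟨hsol, g, -, hsum, hev⟩ := hw
  set α := ρ + D.rowLam a with hαdef
  set c : ℕ → D.Row → ℂ := fun m =>
    (Complex.Gamma (α + 1) / Complex.Gamma (α + 1 + m)) • g m with hc
  have hterm : ∀ (x : ℂ) (m : ℕ),
      (Complex.Gamma (α + 1) / Complex.Gamma (α + 1 + m) * x ^ m) • g m = x ^ m • c m := by
    intro x m
    rw [hc, smul_smul, mul_comm]
  obtain ⟨δ, hδ, hδt, hδcut⟩ := exists_slitDisc η₀ a.1
  obtain ⟨ε, hε, hball⟩ := Metric.mem_nhdsWithin_iff.1 hev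
  set r := min δ ε with hr
  have hr0 : 0 < r := lt_min hδ hε
  set τ := r / 2 with hτdef
  have hτ : 0 < τ := half_pos hr0
  have hs : ∀ x : ℂ, ‖x‖ < r → DifferentiableAt ℂ (fun x => ∑' m : ℕ, x ^ m • c m) x := by
    intro x hx
    obtain ⟨y, hxy, hyr⟩ := exists_between hx
    have hn : ‖(y : ℂ)‖ = y := by
      rw [Complex.norm_real, Real.norm_of_nonneg ((norm_nonneg x).trans hxy.le)]
    have h1 := hsum (D.t' η₀ a.1 + y) fun j hj => by
      rw [add_sub_cancel_left, hn]
      exact hyr.trans_le ((min_le_left _ _).trans (hδt j hj))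
    refine (summable_and_hasDerivAt_tsum_pow_smul (y := (y : ℂ)) (h1.congr fun m => ?_)
      (by rwa [hn])).2.2.differentiableAt
    rw [add_sub_cancel_left]
    exact hterm _ m
  set e := Complex.exp (D.θ' a.1 * Complex.I) with he
  have hne : ‖-((τ : ℂ) * e)‖ = τ := by
    rw [norm_neg, norm_mul, he, Complex.norm_exp_ofReal_mul_I, mul_one, Complex.norm_real,
      Real.norm_of_nonneg hτ.le]
  have hlt : ‖-((τ : ℂ) * e)‖ < r := by rw [hne]; exact half_lt_self hr0
  -- The test point lies on the slit, halfway to the edge of the common disc; H is defined on both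
  -- sides of the slit by the same power series.
  refine eq_zero_of_nonintegral_power hα (φ := D.θ' a.1) hτ
    (H := fun x => ∑ b, v b * ((D.t' η₀ a.1 + x - D.t' η₀ b.1) * (∑' m : ℕ, x ^ m • c m) b))
    ?_ ?_
  · refine tendsto_finsetSum _ fun b _ => ?_
    refine ContinuousAt.mul continuousAt_const (ContinuousAt.mul (by fun_prop) ?_)
    exact ((continuous_apply b).continuousAt).comp (hs _ hlt).continuousAt
  · have h1 : ∀ᶠ x in 𝓝 (-((τ : ℂ) * e)), ‖x‖ < r :=
      continuous_norm.continuousAt.eventually_lt continuousAt_const hlt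
    filter_upwards [h1] with x hx hslit
    have hxs : D.t' η₀ a.1 + x ∈ D.cutPlane η₀ := by
      have h2 : ‖D.t' η₀ a.1 + x - D.t' η₀ a.1‖ < δ := by
        rw [add_sub_cancel_left]; exact hx.trans_le (min_le_left _ _)
      refine (hδcut _ h2).2 ⟨h2, ?_⟩
      rw [add_sub_cancel_left]
      exact hslit
    have h3 := hball ⟨(by
      rw [Metric.mem_ball, dist_eq_norm, add_sub_cancel_left]
      exact hx.trans_le (min_le_right _ _) : D.t' η₀ a.1 + x ∈ Metric.ball (D.t' η₀ a.1) ε), hxs⟩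
    rw [← eq_of_hasDerivAt_zero (hasDerivAt_firstIntegral hv hsol) hxs hζ]
    have h4 : w (D.t' η₀ a.1 + x) =
        Complex.exp (α * logBranch (D.θ' a.1) x) • ∑' m : ℕ, x ^ m • c m := by
      refine Eq.trans h3 ?_
      rw [add_sub_cancel_left]
      exact congrArg₂ _ rfl (tsum_congr fun m => hterm _ m)
    rw [h4, Finset.mul_sum]
    refine Finset.sum_congr rfl fun b _ => ?_
    simp only [Pi.smul_apply, smul_eq_mul]
    ring

end OkuboData

namespace OkuboData

variable {D : OkuboData} {η₀ : ℂ}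

/-- The first integral is a nonintegral power of ζ - η₀ times a function of ζ that is continuous
across the cut ray far out. The factor ζ - T' is left in that function, hence the exponent ρ + μ_b.
-/
theorem IsInfinitySolution.firstIntegral_eq_zero {ρ : ℂ} {v : D.Row → ℂ}
    (hv : v ᵥ* D.A = (-ρ - 1) • v) {b : D.Eig} (hβ : NotInt (ρ + D.mu b.1))
    (hΓ : Complex.Gamma (-ρ - D.mu b.1) ≠ 0)
    {w : ℂ → D.Row → ℂ} (hw : D.IsInfinitySolution η₀ ρ b w) {ζ : ℂ} (hζ : ζ ∈ D.cutPlane η₀) :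
    ∑ a, v a * ((ζ - D.t' η₀ a.1) * w ζ a) = 0 := by
  obtain ⟨h, hd, -, hh⟩ := hw.exists_expansion hΓ
  obtain ⟨r, hr0, hr⟩ := exists_lt_norm_of_forall_mul_lt (c := D.rad) (r := 0) (by simp)
  have hτ : 0 < r⁻¹ := inv_pos.2 hr0
  set φ := D.θ'inf + Real.pi with hφ
  -- Since φ = θ'_∞ + π, this point lies on the cut ray, at a distance r⁻¹ beyond all the t'_i.
  set x₀ := -(((r⁻¹ : ℝ) : ℂ) * Complex.exp (φ * Complex.I)) with hx₀
  have hn : ‖x₀‖ = r⁻¹ := by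
    rw [hx₀, norm_neg, norm_mul, Complex.norm_exp_ofReal_mul_I, mul_one, Complex.norm_real,
      Real.norm_of_nonneg hτ.le]
  have hx₀0 : x₀ ≠ 0 := norm_pos_iff.1 (hn ▸ hτ)
  have hfar : ∀ᶠ x in 𝓝 x₀, ∀ i, D.rad i < ‖x‖ := by
    refine Filter.eventually_all.2 fun i =>
      continuousAt_const.eventually_lt continuous_norm.continuousAt ?_
    rw [hn, lt_inv_comm₀ (D.rad_pos i) hr0, ← one_div, lt_div_iff₀ (D.rad_pos i), mul_comm]
    exact hr i
  refine eq_zero_of_nonintegral_power hβ (φ := φ) hτ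
    (H := fun x => ∑ a, v a * ((η₀ + x - D.t' η₀ a.1) * h x⁻¹ a)) ?_ ?_
  · refine tendsto_finsetSum _ fun a _ => ?_
    refine ContinuousAt.mul continuousAt_const (ContinuousAt.mul (by fun_prop) ?_)
    have h1 : ContinuousAt h x₀⁻¹ := (hd _ fun i => by
      rw [norm_inv, hn, inv_inv]; exact hr i).continuousAt
    exact ((continuous_apply a).continuousAt).comp
      (ContinuousAt.comp h1 (continuousAt_inv₀ hx₀0))
  · filter_upwards [hfar] with x hx hslit
    have hnorm : ∀ i, ‖D.t' η₀ i - η₀‖ < ‖η₀ + x - η₀‖ := fun i => by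
      rw [D.norm_t'_sub, add_sub_cancel_left]; exact hx i
    have hcut : η₀ + x ∈ D.cutPlane η₀ := by
      refine ⟨fun i σ h0 h1 heq => ?_, (D.not_mem_ray_iff η₀ _).2 (by
        rw [add_sub_cancel_left]; exact hslit)⟩
      have h2 := hnorm i
      rw [heq, add_sub_cancel_left, norm_mul, Complex.norm_real, Real.norm_of_nonneg h0] at h2
      exact absurd h2 (not_lt.2 (mul_le_of_le_one_right (norm_nonneg _) h1))
    have hcore := logCut_mem_core hcut hnorm
    have hexp := exp_logCut hcut
    have h3 := hh _ hcore
    rw [Complex.exp_neg, hexp, add_sub_cancel_left] at h3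
    rw [← eq_of_hasDerivAt_zero (hasDerivAt_firstIntegral hv hw.1) hcut hζ, h3, Finset.mul_sum]
    have h4 : D.logCut η₀ (η₀ + x) = logBranch φ x := by rw [logCut, add_sub_cancel_left]
    refine Finset.sum_congr rfl fun a _ => ?_
    simp only [h4, Pi.smul_apply, smul_eq_mul]
    ring

/-- With exponent -1 the first integral is a function G of x = 1/(ζ - η₀), continuous at x = 0.
Being constant, it equals G(0), the pairing of v with the leading coefficient. -/
theorem IsInfinitySolution.firstIntegral_eq {ρ : ℂ} {v : D.Row → ℂ}
    (hv : v ᵥ* D.A = (-ρ - 1) • v) {b : D.Eig} (hβ : ρ + D.mu b.1 = -1)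
    {w : ℂ → D.Row → ℂ} (hw : D.IsInfinitySolution η₀ ρ b w) {ζ : ℂ} (hζ : ζ ∈ D.cutPlane η₀) :
    ∑ a, v a * ((ζ - D.t' η₀ a.1) * w ζ a) = v ⬝ᵥ (D.P *ᵥ Pi.single b 1) := by
  have hone : -ρ - D.mu b.1 = 1 := by linear_combination -hβ
  obtain ⟨h, hd, hh0, hh⟩ := hw.exists_expansion (by rw [hone, Complex.Gamma_one]; exact one_ne_zero)
  set G : ℂ → ℂ := fun x => ∑ a, v a * ((1 + (η₀ - D.t' η₀ a.1) * x) * h x a) with hG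
  have hG0 : G 0 = v ⬝ᵥ (D.P *ᵥ Pi.single b 1) := by
    simp [hG, hh0, dotProduct]
  have hGc : ContinuousAt G 0 := by
    refine tendsto_finsetSum _ fun a _ => ?_
    refine ContinuousAt.mul continuousAt_const (ContinuousAt.mul (by fun_prop) ?_)
    exact ((continuous_apply a).continuousAt).comp (hd 0 (by simp)).continuousAt
  have hGs : ∀ s ∈ D.logCore, G (Complex.exp (-s)) =
      ∑ a, v a * ((ζ - D.t' η₀ a.1) * w ζ a) := by
    intro s hs
    rw [← eq_of_hasDerivAt_zero (hasDerivAt_firstIntegral hv hw.1)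
      (add_exp_mem_cutPlane (D.isRightwardDomain.core_subset hs)) hζ, hh s hs, hβ, neg_one_mul]
    refine Finset.sum_congr rfl fun a _ => ?_
    have hxs : Complex.exp (-s) * Complex.exp s = 1 := by rw [← Complex.exp_add]; simp
    simp only [Pi.smul_apply, smul_eq_mul]
    linear_combination -(v a) * h (Complex.exp (-s)) a * hxs
  rw [← hG0]
  by_contra hne
  obtain ⟨ε, hε, hball⟩ := Metric.eventually_nhds_iff.1 (hGc.eventually_ne (Ne.symm hne))
  obtain ⟨r, hr0, hr⟩ := exists_lt_norm_of_forall_mul_lt (c := fun i : Option (Fin D.p) =>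
    i.elim ε⁻¹ D.rad) (r := 0) (by simp)
  obtain ⟨s, hs, hsr⟩ := exists_mem_logCore hr0 (fun i => hr (some i))
  refine hball (y := Complex.exp (-s)) ?_ (hGs s hs)
  rw [dist_zero_right, hsr]
  have := hr none
  simp only [Option.elim_none] at this
  rwa [inv_mul_lt_iff₀ hε, mul_one] at this

/-! ### The connection coefficients at ρ = -μ_l - 1 -/

theorem Gamma_infinity_ne_zero (D : OkuboData) (l : Fin D.q) (b : D.Eig) (m : ℕ) :
    Complex.Gamma (-(-D.mu l - 1) - D.mu b.1 + m) ≠ 0 := by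
  refine Complex.Gamma_ne_zero fun n h => ?_
  by_cases hb : b.1 = l
  · rw [hb] at h
    have h1 : ((1 + m + n : ℕ) : ℂ) = 0 := by
      push_cast
      linear_combination h
    have := Nat.cast_eq_zero.1 h1
    omega
  · refine D.mu_sub_mu _ _ hb (1 + m + n) ?_
    push_cast
    linear_combination -h

theorem notInt_add_rowLam (l : Fin D.q) (a : D.Row) : NotInt (-D.mu l - 1 + D.rowLam a) := by
  intro z h
  refine D.lam_sub_mu a.1 a.2.1 l (z + 1) ?_
  push_cast
  rw [rowLam] at h
  linear_combination h

theorem exists_isConnectionCoeff (D : OkuboData) (η₀ : ℂ) (l : Fin D.q) :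
    ∃ c : D.Eig → D.Row → ℂ, D.IsConnectionCoeff η₀ (-D.mu l - 1) c := by
  choose winf hinf using fun b =>
    exists_isInfinitySolution η₀ (-D.mu l - 1) b (D.Gamma_infinity_ne_zero l b)
  choose C hC using fun a => exists_isFiniteSolution hinf
    (fun b => by simpa using D.Gamma_infinity_ne_zero l b 0) a (notInt_add_rowLam l a)
  exact ⟨fun b a => C a b, _, winf, hC, hinf, fun a ζ _ => rfl⟩

/-- Take v to be the row of P⁻¹ with index (l, x). Its first integral is 1 on the solution at
infinity with this index and 0 on all the other ones and on the finite solutions, so the connection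
relation reduces to c = 0. -/
theorem IsConnectionCoeff.eq_zero {l : Fin D.q} {c : D.Eig → D.Row → ℂ}
    (hc : D.IsConnectionCoeff η₀ (-D.mu l - 1) c) (x : Fin (D.m l)) (a : D.Row) :
    c ⟨l, x⟩ a = 0 := by
  obtain ⟨wfin, winf, hfin, hinf, hsum⟩ := hc
  obtain ⟨Q, hPQ, hQP⟩ := D.P_invertible
  set v : D.Row → ℂ := Q ⟨l, x⟩ with hvdef
  have hQA : Q * D.A = Matrix.diagonal (fun b : D.Eig => D.mu b.1) * Q := by
    calc Q * D.A = Q * (D.A * D.P) * Q := by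
          rw [Matrix.mul_assoc, Matrix.mul_assoc, hPQ, Matrix.mul_one]
      _ = _ := by rw [D.A_mul_P, ← Matrix.mul_assoc, hQP, Matrix.one_mul]
  have hv : v ᵥ* D.A = (-(-D.mu l - 1) - 1) • v := by
    ext e
    have h1 := congrFun (congrFun hQA ⟨l, x⟩) e
    rw [Matrix.diagonal_mul] at h1
    have h2 : (v ᵥ* D.A) e = (Q * D.A) ⟨l, x⟩ e := rfl
    rw [h2, h1, Pi.smul_apply, smul_eq_mul]
    ring
  obtain ⟨r, hr0, hr⟩ := exists_lt_norm_of_forall_mul_lt (c := D.rad) (r := 0) (by simp)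
  obtain ⟨s, hs, -⟩ := exists_mem_logCore hr0 hr
  have hζ := add_exp_mem_cutPlane (η₀ := η₀) (D.isRightwardDomain.core_subset hs)
  set ζ := η₀ + Complex.exp s
  have hF := (hfin a).firstIntegral_eq_zero hv (notInt_add_rowLam l a) hζ
  rw [hsum a ζ hζ] at hF
  have h1 : ∑ b, v b * ((ζ - D.t' η₀ b.1) * (∑ e, c e a • winf e ζ) b) =
      ∑ e, c e a * ∑ b, v b * ((ζ - D.t' η₀ b.1) * winf e ζ b) := by
    simp only [Finset.sum_apply, Pi.smul_apply, smul_eq_mul, Finset.mul_sum]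
    rw [Finset.sum_comm]
    refine Finset.sum_congr rfl fun e _ => Finset.sum_congr rfl fun b _ => ?_
    ring
  rw [h1, Finset.sum_eq_single ⟨l, x⟩] at hF
  · rw [(hinf ⟨l, x⟩).firstIntegral_eq hv (by ring) hζ] at hF
    have h2 : v ⬝ᵥ (D.P *ᵥ Pi.single (⟨l, x⟩ : D.Eig) 1) = 1 := by
      have : (Q *ᵥ (D.P *ᵥ Pi.single (⟨l, x⟩ : D.Eig) 1)) ⟨l, x⟩ = 1 := by
        rw [Matrix.mulVec_mulVec, hQP, Matrix.one_mulVec, Pi.single_eq_same]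
      exact this
    rwa [h2, mul_one] at hF
  · intro e _ hne
    by_cases he : e.1 = l
    -- Same eigenvalue, different index: the value is an off-diagonal entry of P⁻¹P.
    · rw [(hinf e).firstIntegral_eq hv (by rw [he]; ring) hζ]
      have : (Q *ᵥ (D.P *ᵥ Pi.single e 1)) ⟨l, x⟩ = 0 := by
        rw [Matrix.mulVec_mulVec, hQP, Matrix.one_mulVec, Pi.single_eq_of_ne hne.symm]
      exact mul_eq_zero_of_right _ this
    · rw [(hinf e).firstIntegral_eq_zero hv (fun z h => ?_)
        (by simpa using D.Gamma_infinity_ne_zero l e 0) hζ, mul_zero]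
      refine D.mu_sub_mu _ _ he (z + 1) ?_
      push_cast
      linear_combination h
  · simp

end OkuboData

end

/-- At `ρ = -μ_l - 1` the connection coefficients of the underlying system are defined, and
those from a solution at a finite singularity to the solutions `w_{∞,l,h̃}` vanish. -/
theorem mainTheorem11 (D : OkuboData) (η₀ : ℂ) (l : Fin D.q) :
    (∃ c : D.Eig → D.Row → ℂ, D.IsConnectionCoeff η₀ (-D.mu l - 1) c) ∧
    ∀ c : D.Eig → D.Row → ℂ, D.IsConnectionCoeff η₀ (-D.mu l - 1) c →
      ∀ (htilde : Fin (D.m l)) (i : Fin D.p) (k : Fin (D.r i)) (h : Fin (D.ℓ i k)),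
        c ⟨l, htilde⟩ ⟨i, k, h⟩ = 0 := by
  exact ⟨D.exists_isConnectionCoeff η₀ l, fun _ hc x i k h => hc.eq_zero x ⟨i, k, h⟩⟩
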